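/- Let $d\ge 1$ and $p=(p_1,\dots,p_d)$ with integers $p_i\ge 1$, put $p_0:=\min\{p_1,\dots,p_d\}$, $p\mathbb Z^d:=p_1\mathbb Z\oplus\cdots\oplus p_d\mathbb Z$ and $W:=\prod_{i=1}^d\{0,1,\dots,p_i-1\}$. A function $V:\mathbb Z^d\to\mathbb R$ is *$p$-periodic* if $V(n+m)=V(n)$ for all $n\in\mathbb Z^d$, $m\in p\mathbb Z^d$, and *non-degenerate* if it is injective on $W$; its separation is $\operatorname{sep}V:=\min\{|V(n)-V(m)|: n,m\in W,\ n\ne m\}$ (with value $+\infty$ if $W$ is a single point). For $\mu>0$ let $H_\mu=\Delta+\mu V$ on $\ell^2(\mathbb Z^d)$, i.e. $[H_\mu\psi](n)=\mu V(n)\psi(n)+\sum_{|n-m|_1=1}\psi(m)$, and let $(\delta_n)_{n\in\mathbb Z^d}$ be the canonical basis of $\ell^2(\mathbb Z^d)$. **Theorem.** Let $V$ be $p$-periodic and non-degenerate. (a) For every $\rho_0>0$ there are constants $C,C_1,\mu_0>0$ depending only on $d$, $p$, $\operatorname{sep}V$ and $\rho_0$ such that $$|\langle\delta_n,e^{-itH_\mu}\delta_m\rangle|\le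 C\,e^{-\rho_0\left(|n-m|_1-C_1\mu^{-p_0+1}t\right)}\qquad\text{for all } n,m\in\mathbb Z^d,\ t\ge 0,\ \mu\ge\mu_0 .$$ (b) This rate is optimal: there are constants $c,\mu_1>0$, depending only on $d$, $p$ and $V$, such that for every $\mu\ge\mu_1$, if for some $\rho>0$, $K\in\mathbb R$ and $v_{\mathrm{LR}}\in\mathbb R$ the bound $$|\langle\delta_n,e^{-itH_\mu}\delta_m\rangle|\le K\,e^{-\rho\left(|n-m|_1-v_{\mathrm{LR}}t\right)}\qquad\text{for all } n,m\in\mathbb Z^d,\ t\ge 0$$ holds, then $v_{\mathrm{LR}}\ge c\,\mu^{-p_0+1}$. In particular, if such a bound holds for all large $\mu$ with some $\rho=\rho(\mu)>0$, $K=K(\mu)$ and $v_{\mathrm{LR}}=v_{\mathrm{LR}}(\mu)$, then $v_{\mathrm{LR}}(\mu)\ge c\,\mu^{-p_0+1}$ for all large $\mu$. -/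

import Mathlib

open scoped ENNReal

/-- The Hilbert space `ℓ²(ℤ^d)` of square-summable complex functions on `ℤ^d`. -/
abbrev EllTwo (d : ℕ) : Type := lp (fun _ : Fin d → ℤ => ℂ) 2

/-- The canonical basis vector `δ_n` of `ℓ²(ℤ^d)`. -/
noncomputable def delta {d : ℕ} (n : Fin d → ℤ) : EllTwo d := lp.single 2 n (1 : ℂ)

/-- The `ℓ¹` distance `|n - m|₁` on `ℤ^d`. -/
def lOneDist {d : ℕ} (n m : Fin d → ℤ) : ℤ := ∑ i, |n i - m i|

/-- `V` is `p`-periodic: `V (n + m) = V n` for all `m ∈ p₁ℤ ⊕ ⋯ ⊕ p_dℤ`. -/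
def IsPeriodic {d : ℕ} (p : Fin d → ℕ) (V : (Fin d → ℤ) → ℝ) : Prop :=
  ∀ n k : Fin d → ℤ, V (fun i => n i + (p i : ℤ) * k i) = V n

/-- The fundamental cell `W = [p₁] × ⋯ × [p_d]`, where `[ℓ] = {0, …, ℓ - 1}`. -/
def cell {d : ℕ} (p : Fin d → ℕ) : Set (Fin d → ℤ) :=
  {n | ∀ i, 0 ≤ n i ∧ n i < (p i : ℤ)}

/-- `V` is non-degenerate: it is injective on the fundamental cell. -/
def IsNondegenerate {d : ℕ} (p : Fin d → ℕ) (V : (Fin d → ℤ) → ℝ) : Prop :=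
  Set.InjOn V (cell p)

/-- The separation `min {|V n - V m| : n, m ∈ W, n ≠ m}` of `V`; the minimum over the empty set
(which occurs when `W` has only one point) is `∞`. -/
noncomputable def separation {d : ℕ} (p : Fin d → ℕ) (V : (Fin d → ℤ) → ℝ) : ℝ≥0∞ :=
  ⨅ (n ∈ cell p) (m ∈ cell p) (_ : n ≠ m), ENNReal.ofReal |V n - V m|

/-- The smallest period `p₀ = min {p₁, …, p_d}` (used for `d ≥ 1`). -/
noncomputable def minPeriod {d : ℕ} (p : Fin d → ℕ) : ℕ := ⨅ i, p i

/-- A function is bounded. -/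
def IsBoundedPotential {d : ℕ} (V : (Fin d → ℤ) → ℝ) : Prop := ∃ B : ℝ, ∀ n, |V n| ≤ B

/-- A periodic function is bounded. -/
theorem IsPeriodic.isBounded {d : ℕ} {p : Fin d → ℕ} (hp : ∀ i, 0 < p i)
    {V : (Fin d → ℤ) → ℝ} (hV : IsPeriodic p V) : IsBoundedPotential V := by
  have hfin : (cell p).Finite := by
    refine (Set.Finite.pi' (fun i => Set.finite_Ico (0 : ℤ) (p i))).subset ?_
    intro n hn i
    exact hn i
  obtain ⟨B, hB⟩ := (hfin.image fun n => |V n|).bddAbove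
  refine ⟨B, fun n => ?_⟩
  have h := hV (fun i => n i % (p i : ℤ)) (fun i => n i / (p i : ℤ))
  simp only [Int.emod_add_mul_ediv] at h
  rw [h]
  refine hB ⟨_, fun i => ?_, rfl⟩
  have hpi : (0 : ℤ) < p i := by exact_mod_cast hp i
  exact ⟨Int.emod_nonneg _ hpi.ne', Int.emod_lt_of_pos _ hpi⟩

/-- A real multiple of a bounded function is bounded. -/
theorem IsBoundedPotential.const_mul {d : ℕ} {V : (Fin d → ℤ) → ℝ} (hV : IsBoundedPotential V)
    (μ : ℝ) : IsBoundedPotential (fun n => μ * V n) := by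
  obtain ⟨B, hB⟩ := hV
  refine ⟨|μ| * B, fun n => ?_⟩
  rw [abs_mul]
  exact mul_le_mul_of_nonneg_left (hB n) (abs_nonneg μ)

/-- Norm control of `n ↦ a n * ψ (e n)` for a bounded `a` and a bijection `e`. -/
theorem weightedComp_aux {d : ℕ} (a : (Fin d → ℤ) → ℂ) (B : ℝ) (hB : ∀ n, ‖a n‖ ≤ B)
    (e : (Fin d → ℤ) ≃ (Fin d → ℤ)) (ψ : EllTwo d) :
    ∃ φ : EllTwo d, (∀ n, φ n = a n * ψ (e n)) ∧ ‖φ‖ ≤ B * ‖ψ‖ := by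
  have h2 : (0 : ℝ) < (2 : ℝ≥0∞).toReal := by norm_num
  have hB0 : 0 ≤ B := (norm_nonneg _).trans (hB 0)
  have hs : HasSum (fun n => ‖ψ (e n)‖ ^ (2 : ℝ≥0∞).toReal) (‖ψ‖ ^ (2 : ℝ≥0∞).toReal) :=
    e.hasSum_iff.mpr (lp.hasSum_norm h2 ψ)
  have hs' := hs.mul_left (B ^ (2 : ℝ≥0∞).toReal)
  have hle : ∀ n, ‖a n * ψ (e n)‖ ^ (2 : ℝ≥0∞).toReal
      ≤ B ^ (2 : ℝ≥0∞).toReal * ‖ψ (e n)‖ ^ (2 : ℝ≥0∞).toReal := by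
    intro n
    rw [← Real.mul_rpow hB0 (norm_nonneg _), norm_mul]
    exact Real.rpow_le_rpow (by positivity)
      (mul_le_mul_of_nonneg_right (hB n) (norm_nonneg _)) h2.le
  have hsum : Summable fun n => ‖a n * ψ (e n)‖ ^ (2 : ℝ≥0∞).toReal :=
    Summable.of_nonneg_of_le (fun n => by positivity) hle hs'.summable
  refine ⟨⟨fun n => a n * ψ (e n), memℓp_gen hsum⟩, fun n => rfl, ?_⟩
  refine lp.norm_le_of_tsum_le h2 (by positivity) ?_
  rw [Real.mul_rpow hB0 (norm_nonneg _), ← hs'.tsum_eq]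
  exact hsum.tsum_le_tsum hle hs'.summable

/-- The bounded operator `ψ ↦ (n ↦ a n * ψ (e n))` on `ℓ²(ℤ^d)`, for a bounded `a` and a
bijection `e` of `ℤ^d`. -/
noncomputable def weightedComp {d : ℕ} (a : (Fin d → ℤ) → ℂ) (ha : ∃ B : ℝ, ∀ n, ‖a n‖ ≤ B)
    (e : (Fin d → ℤ) ≃ (Fin d → ℤ)) : EllTwo d →L[ℂ] EllTwo d :=
  LinearMap.mkContinuous
    { toFun := fun ψ => ⟨fun n => a n * ψ (e n), by
        obtain ⟨B, hB⟩ := ha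
        obtain ⟨φ, hφ, -⟩ := weightedComp_aux a B hB e ψ
        exact (funext hφ) ▸ lp.memℓp φ⟩
      map_add' := fun ψ φ => by
        ext n
        exact mul_add _ _ _
      map_smul' := fun c ψ => by
        ext n
        exact mul_left_comm _ _ _ }
    ha.choose
    (fun ψ => by
      obtain ⟨φ, hφ, hn⟩ := weightedComp_aux a ha.choose ha.choose_spec e ψ
      refine le_trans (le_of_eq ?_) hn
      congr 1
      ext n
      exact (hφ n).symm)

/-- The multiplication operator `[Vψ](n) = V n * ψ n` by a bounded real function. -/
noncomputable def potentialOp {d : ℕ} (V : (Fin d → ℤ) → ℝ) (hV : IsBoundedPotential V) :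
    EllTwo d →L[ℂ] EllTwo d :=
  weightedComp (fun n => (V n : ℂ))
    (hV.imp fun _ h n => (Complex.norm_real (V n)).le.trans (h n)) (Equiv.refl _)

/-- The translation `[Sψ](n) = ψ (n + k)`. -/
noncomputable def shiftOp {d : ℕ} (k : Fin d → ℤ) : EllTwo d →L[ℂ] EllTwo d :=
  weightedComp (fun _ => 1) ⟨1, fun _ => norm_one.le⟩ (Equiv.addRight k)

/-- The discrete Laplacian `[Δψ](n) = ∑_{|n - m|₁ = 1} ψ m`; the nearest neighbours of `n` are
the points `n ± e_i`. -/
noncomputable def laplacian (d : ℕ) : EllTwo d →L[ℂ] EllTwo d :=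
  ∑ i : Fin d, (shiftOp (Pi.single i 1) + shiftOp (Pi.single i (-1)))

/-- The Schrödinger operator `H = Δ + V` on `ℓ²(ℤ^d)`, for bounded `V`. -/
noncomputable def schrodinger {d : ℕ} (V : (Fin d → ℤ) → ℝ) (hV : IsBoundedPotential V) :
    EllTwo d →L[ℂ] EllTwo d :=
  laplacian d + potentialOp V hV

/-- The operator `H` acts as expected. -/
theorem schrodinger_apply {d : ℕ} (V : (Fin d → ℤ) → ℝ) (hV : IsBoundedPotential V)
    (ψ : EllTwo d) (n : Fin d → ℤ) :
    schrodinger V hV ψ n = (V n : ℂ) * ψ n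
      + ∑ i : Fin d, (ψ (n + Pi.single i 1) + ψ (n + Pi.single i (-1))) := by
  have h1 : ∀ k : Fin d → ℤ, shiftOp k ψ n = ψ (n + k) := fun k => one_mul _
  have h2 : potentialOp V hV ψ n = (V n : ℂ) * ψ n := rfl
  have h3 : laplacian d ψ n
      = ∑ i : Fin d, (ψ (n + Pi.single i 1) + ψ (n + Pi.single i (-1))) := by
    simp only [laplacian, sum_apply, add_apply,
      lp.coeFn_sum, Finset.sum_apply, lp.coeFn_add, Pi.add_apply, h1]
  rw [schrodinger, add_apply, lp.coeFn_add, Pi.add_apply, h2, h3, add_comm]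

/-- The unitary evolution `e^{-itH}` generated by a bounded operator `H`. -/
noncomputable def evolution {d : ℕ} (H : EllTwo d →L[ℂ] EllTwo d) (t : ℝ) :
    EllTwo d →L[ℂ] EllTwo d :=
  NormedSpace.exp ((-(Complex.I * (t : ℂ))) • H)

/-- The Lieb--Robinson bound with constant `C`, rate `ρ` and velocity `v`:
`|⟨δ_n, e^{-itH} δ_m⟩| ≤ C e^{-ρ (|n - m|₁ - v t)}` for all `n, m ∈ ℤ^d` and all `t ≥ 0`. -/
def LiebRobinsonBound {d : ℕ} (H : EllTwo d →L[ℂ] EllTwo d) (C ρ v : ℝ) : Prop :=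
  ∀ (n m : Fin d → ℤ) (t : ℝ), 0 ≤ t →
    ‖inner ℂ (delta n) (evolution H t (delta m))‖
      ≤ C * Real.exp (-ρ * ((lOneDist n m : ℝ) - v * t))

/-!
Two facts carry the theorem.

*Upper bound.* Conjugation by `e^{η·n}` turns the hopping weights of `H_μ` into `e^{±η_i}`, and the
matrix element of `e^{-itH_μ}` between `m` and `n` is `e^{η·(n-m)}` times that of the conjugated
evolution (`evolution_entry`); with `η_i = ±ρ₀` of the right sign this factor is `e^{-ρ₀|n-m|₁}`. It
remains to bound the growth of the norm of the conjugated evolution. Put `z = 1/μ`. Rayleigh–Schrödinger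
perturbation theory of `V + zΔ`, started at `δ_m`, has real eigenvalue corrections and meets no
vanishing denominator at orders below `p₀`, because `V n = V m` with `n ≠ m` forces
`|n - m|₁ ≥ p₀` (`pertCoeff_eq`). Truncation at order `p₀ - 1` therefore yields an operator `S` close
to the identity with `S⁻¹ H S = (real diagonal) + O(μ^{1-p₀})`, also for the conjugated,
non-hermitian `H`, and only the error makes norms grow (`exists_growth_bound`).

*Lower bound.* Write `h = V + zΔ` and `U = e^{-iτh}` with `τ = tμ`, let `∂` be the commutator with the
coordinate `n_{i₀}`, where `p_{i₀} = p₀`, let `T` be the translation by `p₀ e_{i₀}`, and let `F` be a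
polynomial. The trace per unit cell is cyclic on periodic operators, so that
`tr (T F'(h) U⁻¹ ∂U) = -iτ tr (T F'(h) ∂h) = -iτ tr (T ∂(F(h)))`, and the last trace is `p₀` times the
sum over the cell of the matrix elements of `F(h)` between `r` and `r + p₀ e_{i₀}`
(`exists_commutator_growth`). These elements are `z^{p₀}` times a quantity continuous in `z`, whose
value at `z = 0` is a divided difference of `F`; for a suitable `F` that depends on `V` only, the sum
of these values does not vanish (`exists_leading_ne_zero`). So `∂U` has to grow at least like
`t μ^{1-p₀}`, whereas a Lieb–Robinson bound of velocity `v`, with any rate and any constant, limits the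
growth of `∂U` on the basis vectors to `(v + ε) t + O(1)` (`exists_moment_bound`).
-/

namespace LiebRobinson

variable {d : ℕ}


/-! ### Matrix elements of operators on `ℓ²(ℤ^d)` -/

theorem delta_apply (n m : Fin d → ℤ) : delta m n = if n = m then 1 else 0 := by
  rw [delta, lp.single_apply, Pi.single_apply]

theorem inner_delta (n : Fin d → ℤ) (f : EllTwo d) : inner ℂ (delta n) f = f n := by
  rw [delta, lp.inner_single_left]
  simp

theorem norm_delta (n : Fin d → ℤ) : ‖delta n‖ = 1 := by
  rw [delta, lp.norm_single (by norm_num)]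
  simp

theorem norm_apply_le (f : EllTwo d) (n : Fin d → ℤ) : ‖f n‖ ≤ ‖f‖ :=
  lp.norm_apply_le_norm (by norm_num) f n

/-- The continuous linear functional `ψ ↦ ψ n`. -/
noncomputable def evalCLM (n : Fin d → ℤ) : EllTwo d →L[ℂ] ℂ := innerSL ℂ (delta n)

theorem evalCLM_apply (n : Fin d → ℤ) (f : EllTwo d) : evalCLM n f = f n := by
  rw [evalCLM, innerSL_apply_apply, inner_delta]

/-- A bounded operator is determined by its matrix elements `⟨δ_n, A δ_m⟩`. -/
theorem ext_entry {A B : EllTwo d →L[ℂ] EllTwo d}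
    (h : ∀ n m, A (delta m) n = B (delta m) n) : A = B := by
  refine lp.ext_continuousLinearMap (by norm_num) fun m => ?_
  ext
  exact h _ m

theorem weightedComp_apply (a : (Fin d → ℤ) → ℂ) (ha : ∃ B : ℝ, ∀ n, ‖a n‖ ≤ B)
    (e : (Fin d → ℤ) ≃ (Fin d → ℤ)) (ψ : EllTwo d) (n : Fin d → ℤ) :
    weightedComp a ha e ψ n = a n * ψ (e n) := rfl

theorem weightedComp_norm_le (a : (Fin d → ℤ) → ℂ) (ha : ∃ B : ℝ, ∀ n, ‖a n‖ ≤ B)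
    (e : (Fin d → ℤ) ≃ (Fin d → ℤ)) {B : ℝ} (hB : ∀ n, ‖a n‖ ≤ B) :
    ‖weightedComp a ha e‖ ≤ B := by
  refine ContinuousLinearMap.opNorm_le_bound _ ((norm_nonneg _).trans (hB 0)) fun ψ => ?_
  obtain ⟨φ, hφ, hn⟩ := weightedComp_aux a B hB e ψ
  have : weightedComp a ha e ψ = φ := by
    ext n
    rw [hφ, weightedComp_apply]
  rwa [this]

theorem shiftOp_apply (k : Fin d → ℤ) (ψ : EllTwo d) (n : Fin d → ℤ) :
    shiftOp k ψ n = ψ (n + k) := one_mul _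

theorem shiftOp_norm_le (k : Fin d → ℤ) : ‖shiftOp k‖ ≤ 1 :=
  weightedComp_norm_le _ _ _ fun _ => norm_one.le

theorem shiftOp_delta (k m : Fin d → ℤ) : shiftOp k (delta m) = delta (m - k) := by
  ext n
  rw [shiftOp_apply, delta_apply, delta_apply]
  simp only [eq_sub_iff_add_eq]

theorem potentialOp_apply (V : (Fin d → ℤ) → ℝ) (hV : IsBoundedPotential V)
    (ψ : EllTwo d) (n : Fin d → ℤ) : potentialOp V hV ψ n = (V n : ℂ) * ψ n := rfl

theorem potentialOp_delta (V : (Fin d → ℤ) → ℝ) (hV : IsBoundedPotential V) (m : Fin d → ℤ) :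
    potentialOp V hV (delta m) = (V m : ℂ) • delta m := by
  ext n
  rw [potentialOp_apply, lp.coeFn_smul, Pi.smul_apply, delta_apply, smul_eq_mul]
  split_ifs with h
  · rw [h]
  · simp

theorem potentialOp_norm_le (V : (Fin d → ℤ) → ℝ) (hV : IsBoundedPotential V) {B : ℝ}
    (hB : ∀ n, |V n| ≤ B) : ‖potentialOp V hV‖ ≤ B :=
  weightedComp_norm_le _ _ _ fun n => (Complex.norm_real (V n)).le.trans (hB n)

/-- The exponential series, evaluated at a matrix element. -/
theorem hasSum_exp_entry (c : ℂ) (A : EllTwo d →L[ℂ] EllTwo d) (n m : Fin d → ℤ) :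
    HasSum (fun k : ℕ => ((k.factorial : ℂ)⁻¹ * c ^ k) * (A ^ k) (delta m) n)
      (NormedSpace.exp (c • A) (delta m) n) := by
  have h := NormedSpace.exp_series_hasSum_exp' (𝕂 := ℂ) (c • A)
  have h2 := (((evalCLM n).comp (ContinuousLinearMap.apply ℂ (EllTwo d) (delta m)))).hasSum h
  convert h2 using 2 with k
  · simp [evalCLM_apply, smul_pow, mul_assoc]
  · simp [evalCLM_apply]

/-! ### Unitarity and its perturbations -/

/-- Multiplication by a real function is symmetric. -/
theorem inner_potentialOp_im (V : (Fin d → ℤ) → ℝ) (hV : IsBoundedPotential V) (ψ : EllTwo d) :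
    (inner ℂ ψ (potentialOp V hV ψ)).im = 0 := by
  have h := Complex.hasSum_im (lp.hasSum_inner ψ (potentialOp V hV ψ))
  refine h.unique ?_
  convert hasSum_zero with n
  rw [potentialOp_apply, RCLike.inner_apply, mul_assoc, Complex.mul_conj, ← Complex.ofReal_mul,
    Complex.ofReal_im]

/-- If the anti-hermitian part of `A` has norm at most `r` (as a quadratic form), then
`‖e^{-itA}‖ ≤ e^{rt}`: the square norm of `ψ(t) = e^{-itA} ψ` has derivative
`2 Im ⟨ψ(t), A ψ(t)⟩ ≤ 2 r ‖ψ(t)‖²`. -/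
theorem norm_evolution_le {A : EllTwo d →L[ℂ] EllTwo d} {r : ℝ}
    (hA : ∀ ψ, |(inner ℂ ψ (A ψ)).im| ≤ r * ‖ψ‖ ^ 2) {t : ℝ} (ht : 0 ≤ t) :
    ‖evolution A t‖ ≤ Real.exp (r * t) := by
  refine ContinuousLinearMap.opNorm_le_bound _ (Real.exp_nonneg _) fun ψ => ?_
  set u : ℝ → EllTwo d := fun s => evolution A s ψ with hu
  have hder : ∀ s, HasDerivAt u (-(Complex.I • A (u s))) s := by
    intro s
    have h1 := (hasDerivAt_exp_smul_const' (𝕂 := ℂ) (-(Complex.I • A)) (s : ℂ))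
    have h2 := ((ContinuousLinearMap.apply ℂ (EllTwo d) ψ).hasFDerivAt.comp_hasDerivAt
      (s : ℂ) h1).scomp s Complex.ofRealCLM.hasDerivAt
    have he : ∀ x : ℝ, NormedSpace.exp ((x : ℂ) • (-(Complex.I • A))) = evolution A x := by
      intro x
      rw [evolution, smul_neg, neg_smul, smul_smul, mul_comm]
    have h3 : u = fun x : ℝ => (ContinuousLinearMap.apply ℂ (EllTwo d) ψ)
        (NormedSpace.exp ((x : ℂ) • (-(Complex.I • A)))) := by
      funext x
      rw [he x]
      rfl
    rw [he s] at h2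
    rw [h3]
    refine h2.congr_deriv ?_
    rw [← h3]
    simp [hu]
  have hf : ∀ s, HasDerivAt (fun s => Real.exp (-2 * r * s) * ‖u s‖ ^ 2)
      (Real.exp (-2 * r * s) * (-2 * r) * ‖u s‖ ^ 2
        + Real.exp (-2 * r * s) * (2 * (inner ℂ (u s) (A (u s))).im)) s := by
    intro s
    have h1 : HasDerivAt (fun s => Real.exp (-2 * r * s)) (Real.exp (-2 * r * s) * (-2 * r)) s := by
      have := ((hasDerivAt_id s).const_mul (-2 * r)).exp
      simpa using this
    have h2 : HasDerivAt (fun s => ‖u s‖ ^ 2) (2 * (inner ℂ (u s) (A (u s))).im) s := by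
      have h3 := (hder s).inner ℂ (hder s)
      have h4 := Complex.reCLM.hasFDerivAt.comp_hasDerivAt s h3
      have h5 : (fun s => ‖u s‖ ^ 2) = Complex.reCLM ∘ fun t => inner ℂ (u t) (u t) := by
        funext x
        rw [Function.comp_apply, inner_self_eq_norm_sq_to_K, Complex.reCLM_apply]
        norm_cast
      have hc : (inner ℂ (A (u s)) (u s)).im = -(inner ℂ (u s) (A (u s))).im := by
        rw [← inner_conj_symm, Complex.conj_im]
      rw [h5]
      refine h4.congr_deriv ?_
      rw [Complex.reCLM_apply, inner_neg_right, inner_neg_left, inner_smul_left, inner_smul_right]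
      simp [hc]
      ring
    exact h1.mul h2
  have hanti : Antitone fun s => Real.exp (-2 * r * s) * ‖u s‖ ^ 2 := by
    refine antitone_of_deriv_nonpos (fun s => (hf s).differentiableAt) fun s => ?_
    rw [(hf s).deriv]
    have h1 := (abs_le.1 (hA (u s))).2
    have h2 := Real.exp_pos (-2 * r * s)
    nlinarith
  have h0 : u 0 = ψ := by simp [hu, evolution]
  have h1 := hanti ht
  simp only [h0, mul_zero, Real.exp_zero, one_mul] at h1
  have h2 : ‖u t‖ ^ 2 ≤ (Real.exp (r * t) * ‖ψ‖) ^ 2 := by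
    have h3 : Real.exp (r * t) ^ 2 * Real.exp (-2 * r * t) = 1 := by
      rw [← Real.exp_nat_mul, ← Real.exp_add]
      simp; ring
    calc ‖u t‖ ^ 2 = Real.exp (r * t) ^ 2 * (Real.exp (-2 * r * t) * ‖u t‖ ^ 2) := by
          rw [← mul_assoc, h3, one_mul]
      _ ≤ Real.exp (r * t) ^ 2 * ‖ψ‖ ^ 2 := by gcongr
      _ = _ := by ring
  exact le_of_sq_le_sq h2 (by positivity)


/-! ### The `ℓ¹` distance and the residue classes modulo the periods -/

theorem lOneDist_self (n : Fin d → ℤ) : lOneDist n n = 0 := by simp [lOneDist]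

theorem lOneDist_nonneg (n m : Fin d → ℤ) : 0 ≤ lOneDist n m :=
  Finset.sum_nonneg fun _ _ => abs_nonneg _

theorem abs_sub_le_lOneDist (n m : Fin d → ℤ) (i : Fin d) : |n i - m i| ≤ lOneDist n m :=
  Finset.single_le_sum (f := fun i => |n i - m i|) (fun _ _ => abs_nonneg _) (Finset.mem_univ i)

theorem lOneDist_add_single (n m : Fin d → ℤ) (i : Fin d) (c : ℤ) :
    lOneDist (n + Pi.single i c) m = lOneDist n m - |n i - m i| + |n i + c - m i| := by
  unfold lOneDist
  rw [← Finset.add_sum_erase _ _ (Finset.mem_univ i), ← Finset.add_sum_erase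
    (f := fun i => |n i - m i|) (a := i) _ (Finset.mem_univ i)]
  have : ∑ j ∈ Finset.univ.erase i, |(n + Pi.single i c : Fin d → ℤ) j - m j|
      = ∑ j ∈ Finset.univ.erase i, |n j - m j| := by
    refine Finset.sum_congr rfl fun j hj => ?_
    rw [Pi.add_apply, Pi.single_eq_of_ne (Finset.ne_of_mem_erase hj), add_zero]
  rw [this]
  simp
  ring

theorem exists_minPeriod (hd : 0 < d) (p : Fin d → ℕ) : ∃ i, p i = minPeriod p := by
  have : Nonempty (Fin d) := ⟨⟨0, hd⟩⟩
  exact exists_eq_ciInf_of_finite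

theorem minPeriod_le (p : Fin d → ℕ) (i : Fin d) : minPeriod p ≤ p i :=
  ciInf_le' _ i

section Residue

variable (p : Fin d → ℕ)

/-- The class of `n` in `ℤ^d / pℤ^d = ∏ i, ℤ / p i`. -/
def residue (n : Fin d → ℤ) : ∀ i, ZMod (p i) := fun i => (n i : ZMod (p i))

/-- The representative in the fundamental cell of a class modulo `pℤ^d`. -/
def cellRep (s : ∀ i, ZMod (p i)) : Fin d → ℤ := fun i => ((s i).val : ℤ)

variable {p}

theorem residue_add (n m : Fin d → ℤ) : residue p (n + m) = residue p n + residue p m := by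
  funext i
  simp [residue]

theorem residue_cellRep [∀ i, NeZero (p i)] (s : ∀ i, ZMod (p i)) :
    residue p (cellRep p s) = s := by
  funext i
  simp [residue, cellRep]

theorem cellRep_mem [∀ i, NeZero (p i)] (s : ∀ i, ZMod (p i)) : cellRep p s ∈ cell p :=
  fun i => ⟨Int.natCast_nonneg _, Int.ofNat_lt.2 (ZMod.val_lt (s i))⟩

theorem residue_eq_iff (n m : Fin d → ℤ) :
    residue p n = residue p m ↔ ∃ k : Fin d → ℤ, n = fun i => m i + (p i : ℤ) * k i := by
  constructor
  · intro h
    have h1 : ∀ i, ∃ k : ℤ, n i = m i + (p i : ℤ) * k := by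
      intro i
      have h2 := congrFun h i
      obtain ⟨k, hk⟩ := (ZMod.intCast_eq_intCast_iff_dvd_sub (m i) (n i) (p i)).1 h2.symm
      exact ⟨k, by linarith⟩
    choose k hk using h1
    exact ⟨k, funext hk⟩
  · rintro ⟨k, rfl⟩
    funext i
    simp [residue]

theorem minPeriod_le_lOneDist {n m : Fin d → ℤ} (h : residue p n = residue p m) (hne : n ≠ m) :
    (minPeriod p : ℤ) ≤ lOneDist n m := by
  obtain ⟨i, hi⟩ := Function.ne_iff.1 hne
  have h1 := congrFun h i
  have h2 : (p i : ℤ) ∣ n i - m i :=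
    (ZMod.intCast_eq_intCast_iff_dvd_sub (m i) (n i) (p i)).1 h1.symm
  have h3 : (p i : ℤ) ≤ |n i - m i| :=
    Int.le_of_dvd (abs_pos.2 (sub_ne_zero.2 hi)) ((dvd_abs _ _).2 h2)
  have h4 : (minPeriod p : ℤ) ≤ p i := by exact_mod_cast minPeriod_le p i
  exact h4.trans (h3.trans (abs_sub_le_lOneDist n m i))

variable {V : (Fin d → ℤ) → ℝ}

theorem IsPeriodic.eq_of_residue (hV : IsPeriodic p V) {n m : Fin d → ℤ}
    (h : residue p n = residue p m) : V n = V m := by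
  obtain ⟨k, rfl⟩ := (residue_eq_iff n m).1 h
  exact hV m k

theorem residue_eq_of_eq [∀ i, NeZero (p i)] (hV : IsPeriodic p V) (hnd : IsNondegenerate p V)
    {n m : Fin d → ℤ} (h : V n = V m) : residue p n = residue p m := by
  have key : ∀ n, V (cellRep p (residue p n)) = V n := fun n =>
    IsPeriodic.eq_of_residue hV (residue_cellRep _)
  have h1 := hnd (cellRep_mem (residue p n)) (cellRep_mem (residue p m)) (by rw [key, key, h])
  rw [← residue_cellRep (residue p n), h1, residue_cellRep]

/-- The separation is a positive lower bound for the gaps of `V` on all of `ℤ^d`. If it is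
infinite, then `V` is constant and every number is such a bound; otherwise it is `s.toReal`. -/
theorem exists_gap (p : Fin d → ℕ) [∀ i, NeZero (p i)] (s : ℝ≥0∞) :
    ∃ g : ℝ, 0 < g ∧ ∀ V : (Fin d → ℤ) → ℝ, IsPeriodic p V → IsNondegenerate p V →
      separation p V = s → ∀ n m, V n ≠ V m → g ≤ |V n - V m| := by
  have key : ∀ V : (Fin d → ℤ) → ℝ, IsPeriodic p V → separation p V = s →
      ∀ n m, V n ≠ V m → s ≤ ENNReal.ofReal |V n - V m| := by
    intro V hV hs n m hne
    have key : ∀ n, V (cellRep p (residue p n)) = V n := fun n =>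
      IsPeriodic.eq_of_residue hV (residue_cellRep _)
    rw [← key n, ← key m] at hne ⊢
    rw [← hs, separation]
    exact iInf₂_le_of_le _ (cellRep_mem _) (iInf₂_le_of_le _ (cellRep_mem _)
      (iInf_le_of_le (fun h => hne (by rw [h])) le_rfl))
  by_cases hs : s = ⊤
  · refine ⟨1, one_pos, fun V hV _ hsV n m hne => ?_⟩
    have := key V hV hsV n m hne
    rw [hs, top_le_iff] at this
    exact absurd this ENNReal.ofReal_ne_top
  by_cases hs0 : s = 0
  · refine ⟨1, one_pos, fun V hV hnd hsV => ?_⟩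
    exfalso
    have hfin : (cell p).Finite :=
      (Set.Finite.pi' (fun i => Set.finite_Ico (0 : ℤ) (p i))).subset fun n hn i => hn i
    have hfin2 : ((cell p ×ˢ cell p) ∩ {x | x.1 ≠ x.2}).Finite := (hfin.prod hfin).inter_of_left _
    obtain ⟨ε, hε, hle⟩ : ∃ ε : ℝ, 0 < ε ∧ ∀ x ∈ (cell p ×ˢ cell p) ∩ {x | x.1 ≠ x.2},
        ε ≤ |V x.1 - V x.2| := by
      rcases ((cell p ×ˢ cell p) ∩ {x | x.1 ≠ x.2}).eq_empty_or_nonempty with h | h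
      · exact ⟨1, one_pos, by simp [h]⟩
      · obtain ⟨x, hx, hmin⟩ := Set.exists_min_image _ (fun x => |V x.1 - V x.2|) hfin2 h
        refine ⟨_, ?_, hmin⟩
        rw [abs_pos, sub_ne_zero]
        exact fun h => hx.2 (hnd hx.1.1 hx.1.2 h)
    have h1 : ENNReal.ofReal ε ≤ separation p V :=
      le_iInf₂ fun n hn => le_iInf₂ fun m hm => le_iInf fun hne =>
        ENNReal.ofReal_le_ofReal (hle (n, m) ⟨⟨hn, hm⟩, hne⟩)
    rw [hsV, hs0, nonpos_iff_eq_zero, ENNReal.ofReal_eq_zero] at h1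
    linarith
  · refine ⟨s.toReal, ENNReal.toReal_pos hs0 hs, fun V hV _ hsV n m hne => ?_⟩
    have := ENNReal.toReal_mono ENNReal.ofReal_ne_top (key V hV hsV n m hne)
    rwa [ENNReal.toReal_ofReal (abs_nonneg _)] at this

end Residue

/-! ### Schrödinger operators with exponentially weighted hopping -/

/-- The nearest-neighbour hopping `f ↦ ∑ i, (a i * f (n + e_i) + b i * f (n - e_i))` on arbitrary
functions, with weights `a`, `b` for the two directions. -/
def hop {R : Type*} [Semiring R] (a b : Fin d → R) (f : (Fin d → ℤ) → R) (n : Fin d → ℤ) : R :=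
  ∑ i, (a i * f (n + Pi.single i 1) + b i * f (n + Pi.single i (-1)))

/-- The bounded operator on `ℓ²(ℤ^d)` that is the sum of a potential and a weighted hopping. -/
noncomputable def hopOp (a b : Fin d → ℝ) (V : (Fin d → ℤ) → ℝ) (hV : IsBoundedPotential V) :
    EllTwo d →L[ℂ] EllTwo d :=
  potentialOp V hV
    + ∑ i, ((a i : ℂ) • shiftOp (Pi.single i 1) + (b i : ℂ) • shiftOp (Pi.single i (-1)))

theorem hopOp_apply (a b : Fin d → ℝ) (V : (Fin d → ℤ) → ℝ) (hV : IsBoundedPotential V)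
    (ψ : EllTwo d) (n : Fin d → ℤ) :
    hopOp a b V hV ψ n
      = (V n : ℂ) * ψ n + hop (fun i => (a i : ℂ)) (fun i => (b i : ℂ)) ψ n := by
  simp only [hopOp, hop, add_apply, sum_apply, lp.coeFn_add, lp.coeFn_sum, Pi.add_apply,
    Finset.sum_apply, potentialOp_apply, smul_apply, lp.coeFn_smul,
    Pi.smul_apply, shiftOp_apply, smul_eq_mul]

/-- The weights `e^{η_i}`, `e^{-η_i}` turn `H` into its conjugate by the (unbounded) multiplication
operator `e^{η·n}`; here this is stated for the matrix elements of the powers. -/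
theorem schrodinger_pow_entry (η : Fin d → ℝ) (V : (Fin d → ℤ) → ℝ) (hV : IsBoundedPotential V)
    (k : ℕ) (n m : Fin d → ℤ) :
    ((schrodinger V hV) ^ k) (delta m) n
      = (Real.exp (∑ i, η i * (n i - m i)) : ℂ)
        * ((hopOp (fun i => Real.exp (η i)) (fun i => Real.exp (-η i)) V hV) ^ k) (delta m) n := by
  induction k generalizing n with
  | zero =>
    rw [pow_zero, pow_zero, one_apply_eq_self, delta_apply]
    split_ifs with h
    · simp [h]
    · simp
  | succ k ih =>
    have h1 : ∀ (i : Fin d) (c : ℤ), (Real.exp (∑ j, η j *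
        (((n + Pi.single i c : Fin d → ℤ) j : ℝ) - m j)) : ℂ)
        = (Real.exp (∑ i, η i * (n i - m i)) : ℂ) * Real.exp (η i * c) := by
      intro i c
      rw [← Complex.ofReal_mul, ← Real.exp_add]
      congr 2
      have : η i * c = ∑ j, η j * ((Pi.single i c : Fin d → ℤ) j : ℝ) := by
        rw [Finset.sum_eq_single i]
        · simp
        · intro j _ hj
          simp [Pi.single_eq_of_ne hj]
        · simp
      rw [this, ← Finset.sum_add_distrib]
      refine Finset.sum_congr rfl fun j _ => ?_
      rw [Pi.add_apply]
      push_cast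
      ring
    rw [pow_succ', pow_succ', mul_apply_eq_comp, mul_apply_eq_comp,
      schrodinger_apply, hopOp_apply, hop, mul_add, Finset.mul_sum, ih]
    congr 1
    · ring
    refine Finset.sum_congr rfl fun i _ => ?_
    rw [ih, ih, h1, h1]
    push_cast
    rw [mul_one, mul_neg, mul_one]
    ring

/-- The matrix elements of `e^{-itH}` are those of the conjugated evolution, up to the weight. -/
theorem evolution_entry (η : Fin d → ℝ) (V : (Fin d → ℤ) → ℝ) (hV : IsBoundedPotential V)
    (t : ℝ) (n m : Fin d → ℤ) :
    evolution (schrodinger V hV) t (delta m) n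
      = (Real.exp (∑ i, η i * (n i - m i)) : ℂ)
        * evolution (hopOp (fun i => Real.exp (η i)) (fun i => Real.exp (-η i)) V hV) t
            (delta m) n := by
  refine (hasSum_exp_entry _ _ n m).unique ?_
  refine ((hasSum_exp_entry _ _ n m).mul_left _).congr_fun fun k => ?_
  rw [schrodinger_pow_entry η]
  ring

/-! ### Operators given by a finite-range kernel -/

/-- The displacements whose coordinates are at most `N` in absolute value. -/
noncomputable def box (d N : ℕ) : Finset (Fin d → ℤ) := Fintype.piFinset fun _ => Finset.Icc (-(N : ℤ)) N

theorem mem_box_of_lOneDist {N : ℕ} {n m : Fin d → ℤ} (h : lOneDist n m ≤ N) :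
    m - n ∈ box d N := by
  rw [box, Fintype.mem_piFinset]
  intro i
  have h1 := (abs_sub_le_lOneDist n m i).trans h
  rw [abs_le] at h1
  rw [Finset.mem_Icc, Pi.sub_apply]
  constructor <;> linarith [h1.1, h1.2]

/-- A bounded kernel vanishing at distances larger than `N` defines a bounded operator, with norm at
most the supremum of the kernel times the number of points of a box. -/
theorem exists_kernelOp (N : ℕ) (a : (Fin d → ℤ) → (Fin d → ℤ) → ℝ) {B : ℝ}
    (hB : ∀ n m, |a n m| ≤ B) (ha : ∀ n m, (N : ℤ) < lOneDist n m → a n m = 0) :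
    ∃ A : EllTwo d →L[ℂ] EllTwo d, (∀ n m, A (delta m) n = a n m) ∧
      ‖A‖ ≤ (box d N).card * B := by
  have hb : ∀ k, ∀ n, ‖((a n (n + k) : ℝ) : ℂ)‖ ≤ B := fun k n =>
    (Complex.norm_real _).le.trans (hB _ _)
  refine ⟨∑ k ∈ box d N, weightedComp (fun n => (a n (n + k) : ℂ)) ⟨B, hb k⟩ (Equiv.addRight k),
    fun n m => ?_, ?_⟩
  · simp only [sum_apply, lp.coeFn_sum, Finset.sum_apply, weightedComp_apply, delta_apply,
      Equiv.coe_addRight]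
    rw [Finset.sum_eq_single (m - n)]
    · simp
    · intro k _ hk
      rw [if_neg, mul_zero]
      intro h
      exact hk (by rw [← h]; abel)
    · intro hk
      have h1 : (N : ℤ) < lOneDist n m := by
        by_contra h
        exact hk (mem_box_of_lOneDist (not_lt.1 h))
      simp [ha n m h1]
  · refine (norm_sum_le _ _).trans ?_
    rw [← nsmul_eq_mul]
    exact Finset.sum_le_card_nsmul _ _ _ fun k _ => weightedComp_norm_le _ _ _ (hb k)


/-! ### Rayleigh–Schrödinger coefficients -/

/-- The coefficients of the formal perturbation series for `V + zΔ`, where `Δ` is the weighted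
hopping: the first component of `pertCoeff a b V j` is the order-`j` correction `x_j(n, m)` of the
eigenfunction that starts from `δ_m`, normalized by `x_j(m, m) = 0` for `j ≥ 1`, and the second one
is the order-`j` correction `y_j(m)` of the eigenvalue that starts from `V m`. Where the denominator
`V n - V m` vanishes off the diagonal, the coefficient takes the value `0`. -/
noncomputable def pertCoeff (a b : Fin d → ℝ) (V : (Fin d → ℤ) → ℝ) :
    ℕ → ((Fin d → ℤ) → (Fin d → ℤ) → ℝ) × ((Fin d → ℤ) → ℝ)
  | 0 => (fun n m => if n = m then 1 else 0, V)
  | j + 1 =>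
    (fun n m => if n = m then 0 else
      (∑ i : Fin j, (pertCoeff a b V (i + 1)).1 n m * (pertCoeff a b V (j - i)).2 m
        - hop a b (fun n' => (pertCoeff a b V j).1 n' m) n) / (V n - V m),
    fun m => hop a b (fun n' => (pertCoeff a b V j).1 n' m) m)
  termination_by j => j
  decreasing_by all_goals omega

section Coeff

variable (a b : Fin d → ℝ) (V : (Fin d → ℤ) → ℝ)

/-- The eigenfunction coefficients `x_j(n, m)`. -/
noncomputable def xCoeff (j : ℕ) (n m : Fin d → ℤ) : ℝ := (pertCoeff a b V j).1 n m

/-- The eigenvalue coefficients `y_j(m)`. -/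
noncomputable def yCoeff (j : ℕ) (m : Fin d → ℤ) : ℝ := (pertCoeff a b V j).2 m

theorem xCoeff_zero (n m : Fin d → ℤ) : xCoeff a b V 0 n m = if n = m then 1 else 0 := by
  rw [xCoeff, pertCoeff]

theorem yCoeff_zero (m : Fin d → ℤ) : yCoeff a b V 0 m = V m := by
  rw [yCoeff, pertCoeff]

theorem xCoeff_succ (j : ℕ) (n m : Fin d → ℤ) : xCoeff a b V (j + 1) n m = if n = m then 0 else
    (∑ i ∈ Finset.range j, xCoeff a b V (i + 1) n m * yCoeff a b V (j - i) m
      - hop a b (fun n' => xCoeff a b V j n' m) n) / (V n - V m) := by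
  rw [xCoeff, pertCoeff, Finset.sum_range]
  rfl

theorem yCoeff_succ (j : ℕ) (m : Fin d → ℤ) :
    yCoeff a b V (j + 1) m = hop a b (fun n' => xCoeff a b V j n' m) m := by
  rw [yCoeff, pertCoeff]
  rfl

theorem hop_eq_zero {j : ℤ} {f : (Fin d → ℤ) → ℝ} {m : Fin d → ℤ}
    (hf : ∀ n, j < lOneDist n m → f n = 0) {n : Fin d → ℤ} (hn : j + 1 < lOneDist n m) :
    hop a b f n = 0 := by
  refine Finset.sum_eq_zero fun i _ => ?_
  have h : ∀ c : ℤ, |c| = 1 → f (n + Pi.single i c) = 0 := by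
    intro c hc
    refine hf _ ?_
    rw [lOneDist_add_single]
    have : |n i - m i| ≤ |n i + c - m i| + |c| := by
      rw [← abs_neg c]
      refine le_trans (le_of_eq ?_) (abs_add_le _ _)
      congr 1
      ring
    linarith
  rw [h 1 (by simp), h (-1) (by simp)]
  ring

/-- The order-`j` coefficient has range at most `j`. -/
theorem xCoeff_eq_zero (j : ℕ) (n m : Fin d → ℤ) (h : (j : ℤ) < lOneDist n m) :
    xCoeff a b V j n m = 0 := by
  induction j using Nat.strong_induction_on generalizing n with
  | _ j ih =>
    cases j with
    | zero =>
      rw [xCoeff_zero, if_neg]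
      rintro rfl
      rw [lOneDist_self] at h
      exact absurd h (by simp)
    | succ j =>
      rw [xCoeff_succ, hop_eq_zero a b (j := j) (m := m) (fun n' hn' => ih j (by omega) n' hn')
        (by exact_mod_cast h), Finset.sum_eq_zero]
      · simp
      · intro i hi
        have := Finset.mem_range.1 hi
        rw [ih (i + 1) (by omega) n (lt_trans (by omega) h), zero_mul]

/-- The eigenvalue equation `(V + zΔ) x = x y`, order by order. It holds below the order at which
the hopping first connects two points with the same value of `V`. -/
theorem pertCoeff_eq {M : ℕ} (hM : ∀ n m, V n = V m → n ≠ m → (M : ℤ) ≤ lOneDist n m)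
    {j : ℕ} (hj : j + 1 < M) (n m : Fin d → ℤ) :
    V n * xCoeff a b V (j + 1) n m + hop a b (fun n' => xCoeff a b V j n' m) n
      = ∑ i ∈ Finset.range (j + 2), xCoeff a b V i n m * yCoeff a b V (j + 1 - i) m := by
  rw [Finset.sum_range_succ, Finset.sum_range_succ']
  have h1 : ∀ i, j + 1 - (i + 1) = j - i := fun i => by omega
  simp only [h1, Nat.sub_zero, Nat.sub_self, yCoeff_zero]
  by_cases h : n = m
  · subst h
    rw [Finset.sum_eq_zero fun i _ => ?_, xCoeff_zero, if_pos rfl, yCoeff_succ, xCoeff_succ,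
      if_pos rfl]
    · ring
    · rw [xCoeff_succ, if_pos rfl, zero_mul]
  · rw [xCoeff_zero, if_neg h, xCoeff_succ, if_neg h]
    by_cases hV : V n = V m
    · have h2 := hM n m hV h
      rw [hop_eq_zero a b (j := j) (m := m) (fun n' hn' => xCoeff_eq_zero a b V j n' m hn')
        (lt_of_lt_of_le (by exact_mod_cast hj) h2), Finset.sum_eq_zero]
      · simp
      · intro i hi
        have := Finset.mem_range.1 hi
        rw [xCoeff_eq_zero a b V (i + 1) n m (lt_of_lt_of_le (by omega) h2), zero_mul]
    · have h3 : V n - V m ≠ 0 := sub_ne_zero.2 hV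
      field_simp
      ring

variable {a b}

theorem abs_hop_le {w B : ℝ} (ha : ∀ i, |a i| ≤ w) (hb : ∀ i, |b i| ≤ w)
    {f : (Fin d → ℤ) → ℝ} (hf : ∀ n, |f n| ≤ B) (n : Fin d → ℤ) :
    |hop a b f n| ≤ 2 * d * w * B := by
  refine (Finset.abs_sum_le_sum_abs _ _).trans ?_
  have : ∀ i ∈ Finset.univ, |a i * f (n + Pi.single i 1) + b i * f (n + Pi.single i (-1))|
      ≤ 2 * w * B := by
    intro i _
    refine (abs_add_le _ _).trans ?_
    rw [abs_mul, abs_mul]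
    have hw : 0 ≤ w := (abs_nonneg _).trans (ha i)
    have h1 := mul_le_mul (ha i) (hf (n + Pi.single i 1)) (abs_nonneg _) hw
    have h2 := mul_le_mul (hb i) (hf (n + Pi.single i (-1))) (abs_nonneg _) hw
    linarith
  refine (Finset.sum_le_card_nsmul _ _ _ this).trans (le_of_eq ?_)
  rw [nsmul_eq_mul, Finset.card_univ, Fintype.card_fin]
  ring

end Coeff

/-- The perturbation coefficients are bounded in terms of the dimension, the hopping weights and
the gap of the potential only; `y_0 = V` is excepted. -/
theorem exists_coeff_bound (d : ℕ) {w g : ℝ} (hw : 0 ≤ w) (hg : 0 < g) (N : ℕ) :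
    ∃ B : ℝ, 1 ≤ B ∧ ∀ (a b : Fin d → ℝ) (V : (Fin d → ℤ) → ℝ), (∀ i, |a i| ≤ w) →
      (∀ i, |b i| ≤ w) → (∀ n m, V n ≠ V m → g ≤ |V n - V m|) →
      ∀ j ≤ N, (∀ n m, |xCoeff a b V j n m| ≤ B) ∧ (1 ≤ j → ∀ m, |yCoeff a b V j m| ≤ B) := by
  induction N with
  | zero =>
    refine ⟨1, le_rfl, fun a b V _ _ _ j hj => ?_⟩
    obtain rfl : j = 0 := by omega
    refine ⟨fun n m => ?_, by omega⟩
    rw [xCoeff_zero]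
    split_ifs <;> simp
  | succ N ih =>
    obtain ⟨B, hB1, hB⟩ := ih
    have hB0 : 0 ≤ B := by linarith
    refine ⟨B + 2 * d * w * B + (N * (B * B) + 2 * d * w * B) / g, ?_, ?_⟩
    · have : 0 ≤ 2 * d * w * B + (N * (B * B) + 2 * d * w * B) / g := by positivity
      linarith
    intro a b V ha hb hV j hj
    have hold := hB a b V ha hb hV
    rcases Nat.lt_or_ge j (N + 1) with h | h
    · have h1 := hold j (by omega)
      have : 0 ≤ 2 * d * w * B + (N * (B * B) + 2 * d * w * B) / g := by positivity
      exact ⟨fun n m => (h1.1 n m).trans (by linarith),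
        fun hj m => (h1.2 hj m).trans (by linarith)⟩
    · obtain rfl : j = N + 1 := by omega
      have hhop : ∀ n m, |hop a b (fun n' => xCoeff a b V N n' m) n| ≤ 2 * d * w * B :=
        fun n m => abs_hop_le ha hb (fun n' => (hold N le_rfl).1 n' m) n
      have hp1 : 0 ≤ 2 * d * w * B := by positivity
      have hp2 : 0 ≤ (N * (B * B) + 2 * d * w * B) / g := by positivity
      refine ⟨fun n m => ?_, fun _ m => ?_⟩
      · rw [xCoeff_succ]
        split_ifs with hnm
        · rw [abs_zero]
          linarith
        by_cases hVnm : V n = V m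
        · rw [hVnm, sub_self, div_zero, abs_zero]
          linarith
        rw [abs_div]
        have hnum : |∑ i ∈ Finset.range N, xCoeff a b V (i + 1) n m * yCoeff a b V (N - i) m
            - hop a b (fun n' => xCoeff a b V N n' m) n| ≤ N * (B * B) + 2 * d * w * B := by
          refine (abs_sub _ _).trans (add_le_add ?_ (hhop n m))
          refine (Finset.abs_sum_le_sum_abs _ _).trans ?_
          have : ∀ i ∈ Finset.range N,
              |xCoeff a b V (i + 1) n m * yCoeff a b V (N - i) m| ≤ B * B := by
            intro i hi
            have := Finset.mem_range.1 hi
            rw [abs_mul]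
            exact mul_le_mul ((hold (i + 1) (by omega)).1 n m)
              ((hold (N - i) (by omega)).2 (by omega) m) (abs_nonneg _) hB0
          refine (Finset.sum_le_card_nsmul _ _ _ this).trans (le_of_eq ?_)
          rw [nsmul_eq_mul, Finset.card_range]
        have := div_le_div₀ (by positivity) hnum hg (hV n m hVnm)
        linarith
      · rw [yCoeff_succ]
        exact (hhop m m).trans (by linarith)


/-! ### Approximate diagonalization and the upper bound -/

/-- The truncated perturbation series satisfies the eigenvalue equation up to terms of order `z^M`:
in the product of the two truncated series, the pairs `(i, l)` with `i + l < M` match the orders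
below `M`, and the remaining ones have `l ≥ 1` and `i + l ≥ M`. -/
theorem truncated_pertCoeff_eq (a b : Fin d → ℝ) (V : (Fin d → ℤ) → ℝ) {N : ℕ}
    (hM : ∀ n m, V n = V m → n ≠ m → ((N + 1 : ℕ) : ℤ) ≤ lOneDist n m) (z : ℝ)
    (n m : Fin d → ℤ) :
    V n * (∑ j ∈ Finset.range (N + 1), z ^ j * xCoeff a b V j n m)
      + z * hop a b (fun n' => ∑ j ∈ Finset.range (N + 1), z ^ j * xCoeff a b V j n' m) n
      = (∑ j ∈ Finset.range (N + 1), z ^ j * yCoeff a b V j m)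
          * (∑ j ∈ Finset.range (N + 1), z ^ j * xCoeff a b V j n m)
        + (z ^ (N + 1) * hop a b (fun n' => xCoeff a b V N n' m) n
          - ∑ i ∈ Finset.range (N + 1), ∑ l ∈ Finset.Ico (N + 1 - i) (N + 1),
              z ^ (i + l) * (xCoeff a b V i n m * yCoeff a b V l m)) := by
  have hhop : z * hop a b (fun n' => ∑ j ∈ Finset.range (N + 1), z ^ j * xCoeff a b V j n' m) n
      = ∑ j ∈ Finset.range (N + 1), z ^ (j + 1) * hop a b (fun n' => xCoeff a b V j n' m) n := by
    simp only [hop, Finset.mul_sum, ← Finset.sum_add_distrib]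
    rw [Finset.sum_comm]
    refine Finset.sum_congr rfl fun j _ => Finset.sum_congr rfl fun i _ => ?_
    ring
  have hprod : (∑ j ∈ Finset.range (N + 1), z ^ j * yCoeff a b V j m)
        * (∑ j ∈ Finset.range (N + 1), z ^ j * xCoeff a b V j n m)
      = (∑ i ∈ Finset.range (N + 1), ∑ l ∈ Finset.range (N + 1 - i),
          z ^ (i + l) * (xCoeff a b V i n m * yCoeff a b V l m))
        + ∑ i ∈ Finset.range (N + 1), ∑ l ∈ Finset.Ico (N + 1 - i) (N + 1),
            z ^ (i + l) * (xCoeff a b V i n m * yCoeff a b V l m) := by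
    rw [mul_comm, Finset.sum_mul_sum, ← Finset.sum_add_distrib]
    refine Finset.sum_congr rfl fun i _ => ?_
    rw [Finset.range_eq_Ico, Finset.range_eq_Ico,
      Finset.sum_Ico_consecutive _ (Nat.zero_le _) (Nat.sub_le _ _)]
    refine Finset.sum_congr rfl fun l _ => ?_
    ring
  have hlow : ∀ j ∈ Finset.range (N + 1), ∑ i ∈ Finset.range (j + 1),
        z ^ (i + (j - i)) * (xCoeff a b V i n m * yCoeff a b V (j - i) m)
      = z ^ j * ∑ i ∈ Finset.range (j + 1), xCoeff a b V i n m * yCoeff a b V (j - i) m := by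
    intro j _
    rw [Finset.mul_sum]
    refine Finset.sum_congr rfl fun i hi => ?_
    have := Finset.mem_range.1 hi
    rw [Nat.add_sub_of_le (by omega)]
  rw [hhop, hprod, ← Finset.sum_range_diag_flip (N + 1)
    (fun i l => z ^ (i + l) * (xCoeff a b V i n m * yCoeff a b V l m)), Finset.sum_congr rfl hlow,
    Finset.sum_range_succ' (fun j => z ^ j * ∑ i ∈ Finset.range (j + 1), _),
    Finset.sum_range_succ' (fun j => z ^ j * xCoeff a b V j n m),
    Finset.sum_range_succ (fun j => z ^ (j + 1) * _)]
  have h0 : V n * xCoeff a b V 0 n m = xCoeff a b V 0 n m * V m := by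
    rw [xCoeff_zero]
    split_ifs with h
    · rw [h]
      ring
    · ring
  have hsum : V n * ∑ j ∈ Finset.range N, z ^ (j + 1) * xCoeff a b V (j + 1) n m
        + ∑ j ∈ Finset.range N, z ^ (j + 1) * hop a b (fun n' => xCoeff a b V j n' m) n
      = ∑ j ∈ Finset.range N, z ^ (j + 1)
          * ∑ i ∈ Finset.range (j + 2), xCoeff a b V i n m * yCoeff a b V (j + 1 - i) m := by
    rw [Finset.mul_sum, ← Finset.sum_add_distrib]
    refine Finset.sum_congr rfl fun j hj => ?_
    rw [← pertCoeff_eq a b V hM (by simpa using hj)]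
    ring
  simp only [zero_add, Finset.sum_range_one, Nat.sub_self, yCoeff_zero, pow_zero, one_mul]
  linarith [h0, hsum]

/-- An evolution is bounded through a similarity transformation of its generator. -/
theorem norm_evolution_conj_le {H A : EllTwo d →L[ℂ] EllTwo d} (S : (EllTwo d →L[ℂ] EllTwo d)ˣ)
    (h : H * S = S * A) (t : ℝ) :
    ‖evolution H t‖ ≤ ‖(S : EllTwo d →L[ℂ] EllTwo d)‖ * ‖evolution A t‖
      * ‖((S⁻¹ : (EllTwo d →L[ℂ] EllTwo d)ˣ) : EllTwo d →L[ℂ] EllTwo d)‖ := by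
  have h1 : H = S * A * ((S⁻¹ : (EllTwo d →L[ℂ] EllTwo d)ˣ) : EllTwo d →L[ℂ] EllTwo d) := by
    rw [← h, Units.mul_inv_cancel_right]
  have h2 : evolution H t = S * evolution A t
      * ((S⁻¹ : (EllTwo d →L[ℂ] EllTwo d)ˣ) : EllTwo d →L[ℂ] EllTwo d) := by
    let _ : NormedAlgebra ℚ (EllTwo d →L[ℂ] EllTwo d) := NormedAlgebra.restrictScalars ℚ ℂ _
    rw [evolution, evolution, ← NormedSpace.exp_units_conj, mul_smul_comm, smul_mul_assoc, ← h1]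
  rw [h2]
  exact (norm_mul_le _ _).trans (mul_le_mul_of_nonneg_right (norm_mul_le _ _) (norm_nonneg _))

/-- Uniform growth bound for the weighted evolutions. Here `N + 1` is a lower bound for the distance
of points with equal potential, and `g` one for the gaps of the potential. -/
theorem exists_growth_bound (d : ℕ) {w g : ℝ} (hw : 0 ≤ w) (hg : 0 < g) (N : ℕ) :
    ∃ K μ₀ : ℝ, 0 < K ∧ 1 ≤ μ₀ ∧ ∀ (a b : Fin d → ℝ) (V : (Fin d → ℤ) → ℝ)
      (hb : IsBoundedPotential V), (∀ i, |a i| ≤ w) → (∀ i, |b i| ≤ w) →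
      (∀ n m, V n ≠ V m → g ≤ |V n - V m|) →
      (∀ n m, V n = V m → n ≠ m → ((N + 1 : ℕ) : ℤ) ≤ lOneDist n m) →
      ∀ μ : ℝ, μ₀ ≤ μ → ∀ t : ℝ, 0 ≤ t →
        ‖evolution (hopOp a b (fun n => μ * V n) (hb.const_mul μ)) t‖
          ≤ 3 * Real.exp (K * (μ * (μ⁻¹) ^ (N + 1)) * t) := by
  obtain ⟨B, hB1, hcoeff⟩ := exists_coeff_bound d hw hg N
  have hB0 : 0 < B := by linarith
  have hcard : ∀ L, (0 : ℝ) < (box d L).card := fun L => by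
    refine Nat.cast_pos.2 (Finset.card_pos.2 ⟨0, ?_⟩)
    simpa using mem_box_of_lOneDist (N := L) (n := (0 : Fin d → ℤ)) (m := 0)
      (by rw [lOneDist_self]; positivity)
  set KE : ℝ := (box d (N + 1)).card * (2 * d * w * B + (N + 1 : ℕ) * ((N + 1 : ℕ) * (B * B)))
    with hKE
  have hKE0 : 0 < KE := mul_pos (hcard _) (by positivity)
  refine ⟨2 * KE, max 1 (2 * ((box d N).card * (N * B))), by positivity, le_max_left _ _, ?_⟩
  intro a b V hbd ha hb hV hM μ hμ t ht
  have hμ1 : 1 ≤ μ := (le_max_left _ _).trans hμ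
  have hμ0 : 0 < μ := by linarith
  set z := μ⁻¹ with hz
  have hz0 : 0 < z := inv_pos.2 hμ0
  have hz1 : z ≤ 1 := inv_le_one_of_one_le₀ hμ1
  have hold := hcoeff a b V ha hb hV
  -- the correction `X = ∑_{1 ≤ j ≤ N} z ^ j x_j` to the identity
  obtain ⟨X, hX, hXn⟩ := exists_kernelOp N
    (fun n m => ∑ j ∈ Finset.range N, z ^ (j + 1) * xCoeff a b V (j + 1) n m) (B := N * (z * B))
    (by
      intro n m
      refine (Finset.abs_sum_le_sum_abs _ _).trans ?_
      have : ∀ j ∈ Finset.range N, |z ^ (j + 1) * xCoeff a b V (j + 1) n m| ≤ z * B := by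
        intro j hj
        have := Finset.mem_range.1 hj
        rw [abs_mul, abs_of_nonneg (by positivity)]
        refine mul_le_mul ?_ ((hold (j + 1) (by omega)).1 n m) (abs_nonneg _) hz0.le
        exact pow_le_of_le_one hz0.le hz1 (by omega)
      refine (Finset.sum_le_card_nsmul _ _ _ this).trans (le_of_eq ?_)
      rw [nsmul_eq_mul, Finset.card_range])
    (by
      intro n m h
      refine Finset.sum_eq_zero fun j hj => ?_
      have := Finset.mem_range.1 hj
      rw [xCoeff_eq_zero a b V _ n m (lt_of_le_of_lt (by omega) h), mul_zero])
  -- the error of the truncated eigenvalue equation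
  obtain ⟨E, hE, hEn⟩ := exists_kernelOp (N + 1)
    (fun n m => z ^ (N + 1) * hop a b (fun n' => xCoeff a b V N n' m) n
      - ∑ i ∈ Finset.range (N + 1), ∑ l ∈ Finset.Ico (N + 1 - i) (N + 1),
          z ^ (i + l) * (xCoeff a b V i n m * yCoeff a b V l m))
    (B := z ^ (N + 1) * (2 * d * w * B + (N + 1 : ℕ) * ((N + 1 : ℕ) * (B * B))))
    (by
      intro n m
      refine (abs_sub _ _).trans ?_
      rw [mul_add]
      refine add_le_add ?_ ?_
      · rw [abs_mul, abs_of_nonneg (by positivity)]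
        exact mul_le_mul_of_nonneg_left
          (abs_hop_le ha hb (fun n' => (hold N le_rfl).1 n' m) n) (by positivity)
      have h1 : ∀ i ∈ Finset.range (N + 1), ∀ l ∈ Finset.Ico (N + 1 - i) (N + 1),
          |z ^ (i + l) * (xCoeff a b V i n m * yCoeff a b V l m)| ≤ z ^ (N + 1) * (B * B) := by
        intro i hi l hl
        have hi := Finset.mem_range.1 hi
        have hl := Finset.mem_Ico.1 hl
        rw [abs_mul, abs_mul, abs_of_nonneg (by positivity)]
        refine mul_le_mul (pow_le_pow_of_le_one hz0.le hz1 (by omega)) ?_ (by positivity)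
          (by positivity)
        exact mul_le_mul ((hold i (by omega)).1 n m) ((hold l (by omega)).2 (by omega) m)
          (abs_nonneg _) hB0.le
      have h2 : ∀ i ∈ Finset.range (N + 1), |∑ l ∈ Finset.Ico (N + 1 - i) (N + 1),
          z ^ (i + l) * (xCoeff a b V i n m * yCoeff a b V l m)|
            ≤ (N + 1 : ℕ) * (z ^ (N + 1) * (B * B)) := by
        intro i hi
        refine (Finset.abs_sum_le_sum_abs _ _).trans
          ((Finset.sum_le_card_nsmul _ _ _ (h1 i hi)).trans ?_)
        rw [nsmul_eq_mul, Nat.card_Ico]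
        refine mul_le_mul_of_nonneg_right ?_ (by positivity)
        exact Nat.cast_le.2 (Nat.sub_le _ _)
      refine (Finset.abs_sum_le_sum_abs _ _).trans
        ((Finset.sum_le_card_nsmul _ _ _ h2).trans (le_of_eq ?_))
      rw [nsmul_eq_mul, Finset.card_range]
      ring)
    (by
      intro n m h
      rw [hop_eq_zero a b (j := N) (m := m) (fun n' hn' => xCoeff_eq_zero a b V N n' m hn')
        (by exact_mod_cast h), mul_zero, zero_sub, neg_eq_zero]
      refine Finset.sum_eq_zero fun i hi => Finset.sum_eq_zero fun l _ => ?_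
      have := Finset.mem_range.1 hi
      rw [xCoeff_eq_zero a b V i n m (lt_of_le_of_lt (by omega) h), zero_mul, mul_zero])
  -- the real diagonal part, in the normalization of `H`
  have hYb : IsBoundedPotential fun m =>
      μ * ∑ j ∈ Finset.range (N + 1), z ^ j * yCoeff a b V j m := by
    refine IsBoundedPotential.const_mul ?_ μ
    obtain ⟨BV, hBV⟩ := hbd
    refine ⟨N * B + BV, fun m => ?_⟩
    beta_reduce
    rw [Finset.sum_range_succ', pow_zero, one_mul, yCoeff_zero]
    refine (abs_add_le _ _).trans (add_le_add ?_ (hBV m))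
    refine (Finset.abs_sum_le_sum_abs _ _).trans ?_
    have : ∀ j ∈ Finset.range N, |z ^ (j + 1) * yCoeff a b V (j + 1) m| ≤ B := by
      intro j hj
      have := Finset.mem_range.1 hj
      rw [abs_mul, abs_of_nonneg (by positivity)]
      calc z ^ (j + 1) * |yCoeff a b V (j + 1) m| ≤ 1 * B :=
            mul_le_mul (pow_le_one₀ hz0.le hz1) ((hold (j + 1) (by omega)).2 (by omega) m)
              (abs_nonneg _) zero_le_one
        _ = B := one_mul B
    refine (Finset.sum_le_card_nsmul _ _ _ this).trans (le_of_eq ?_)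
    rw [nsmul_eq_mul, Finset.card_range]
  set Y := potentialOp _ hYb with hY
  have hXhalf : ‖X‖ ≤ 1 / 2 := by
    have h1 := (le_max_right _ _).trans hμ
    calc ‖X‖ ≤ (box d N).card * (N * (z * B)) := hXn
      _ = 2 * ((box d N).card * (N * B)) * z / 2 := by ring
      _ ≤ μ * z / 2 := by gcongr
      _ = 1 / 2 := by rw [hz, mul_inv_cancel₀ hμ0.ne']
  have hXlt : ‖-X‖ < 1 := by
    rw [norm_neg]
    linarith
  set S := Units.oneSub (-X) hXlt with hS
  have hSval : (S : EllTwo d →L[ℂ] EllTwo d) = 1 + X := by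
    rw [hS, Units.val_oneSub, sub_neg_eq_add]
  have hone : ‖(1 : EllTwo d →L[ℂ] EllTwo d)‖ ≤ 1 := ContinuousLinearMap.norm_id_le
  have hSn : ‖(S : EllTwo d →L[ℂ] EllTwo d)‖ ≤ 3 / 2 := by
    rw [hSval]
    refine (norm_add_le _ _).trans ?_
    linarith
  have hSinv : ‖((S⁻¹ : (EllTwo d →L[ℂ] EllTwo d)ˣ) : EllTwo d →L[ℂ] EllTwo d)‖ ≤ 2 := by
    have h1 : ((S⁻¹ : (EllTwo d →L[ℂ] EllTwo d)ˣ) : EllTwo d →L[ℂ] EllTwo d)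
        = ∑' n : ℕ, (-X) ^ n := rfl
    rw [h1]
    refine (tsum_geometric_le_of_norm_lt_one (-X) hXlt).trans ?_
    rw [norm_neg]
    have h2 : (1 - ‖X‖)⁻¹ ≤ 2 := by
      rw [inv_le_comm₀ (by linarith) (by norm_num)]
      linarith
    linarith
  have hSentry : ∀ n m, (S : EllTwo d →L[ℂ] EllTwo d) (delta m) n
      = ((∑ j ∈ Finset.range (N + 1), z ^ j * xCoeff a b V j n m : ℝ) : ℂ) := by
    intro n m
    rw [hSval, add_apply, one_apply_eq_self, lp.coeFn_add, Pi.add_apply, hX,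
      Finset.sum_range_succ', pow_zero, one_mul, xCoeff_zero, delta_apply]
    push_cast
    rw [add_comm, apply_ite Complex.ofReal, Complex.ofReal_one, Complex.ofReal_zero]
  set A : EllTwo d →L[ℂ] EllTwo d :=
    Y + ((S⁻¹ : (EllTwo d →L[ℂ] EllTwo d)ˣ) : EllTwo d →L[ℂ] EllTwo d) * ((μ : ℂ) • E) with hA
  have hconj : hopOp a b (fun n => μ * V n) (hbd.const_mul μ) * S = S * A := by
    rw [hA, mul_add, Units.mul_inv_cancel_left]
    refine ext_entry fun n m => ?_
    rw [mul_apply_eq_comp, hopOp_apply, add_apply, mul_apply_eq_comp, hY, potentialOp_delta,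
      map_smul, lp.coeFn_add, Pi.add_apply, lp.coeFn_smul, Pi.smul_apply, smul_apply,
      lp.coeFn_smul, Pi.smul_apply, hE, hSentry, smul_eq_mul, smul_eq_mul]
    have hcast : hop (fun i => (a i : ℂ)) (fun i => (b i : ℂ))
          ((S : EllTwo d →L[ℂ] EllTwo d) (delta m)) n
        = ((hop a b (fun n' => ∑ j ∈ Finset.range (N + 1), z ^ j * xCoeff a b V j n' m) n : ℝ)
            : ℂ) := by
      simp only [hop, hSentry]
      push_cast
      rfl
    rw [hcast]
    have hμz : μ * z = 1 := mul_inv_cancel₀ hμ0.ne'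
    have key := congrArg (fun x : ℝ => ((μ * x : ℝ) : ℂ)) (truncated_pertCoeff_eq a b V hM z n m)
    beta_reduce at key
    rw [mul_add, ← mul_assoc, ← mul_assoc, hμz, one_mul, mul_add, ← mul_assoc] at key
    simp only [← Complex.ofReal_mul, ← Complex.ofReal_add]
    exact key
  have hSE : ‖((S⁻¹ : (EllTwo d →L[ℂ] EllTwo d)ˣ) : EllTwo d →L[ℂ] EllTwo d) * ((μ : ℂ) • E)‖
      ≤ 2 * KE * (μ * z ^ (N + 1)) := by
    refine (norm_mul_le _ _).trans ?_
    rw [norm_smul, Complex.norm_real, Real.norm_of_nonneg hμ0.le]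
    calc _ ≤ 2 * (μ * ((box d (N + 1)).card * (z ^ (N + 1)
          * (2 * d * w * B + (N + 1 : ℕ) * ((N + 1 : ℕ) * (B * B)))))) := by
          gcongr
      _ = _ := by
          rw [hKE]
          ring
  have hAim : ∀ ψ, |(inner ℂ ψ (A ψ)).im| ≤ 2 * KE * (μ * z ^ (N + 1)) * ‖ψ‖ ^ 2 := by
    intro ψ
    rw [hA, add_apply, inner_add_right, Complex.add_im, hY, inner_potentialOp_im, zero_add]
    refine (Complex.abs_im_le_norm _).trans ((norm_inner_le_norm _ _).trans ?_)
    have h1 := (ContinuousLinearMap.le_opNorm _ ψ).trans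
      (mul_le_mul_of_nonneg_right hSE (norm_nonneg ψ))
    calc _ ≤ ‖ψ‖ * (2 * KE * (μ * z ^ (N + 1)) * ‖ψ‖) :=
          mul_le_mul_of_nonneg_left h1 (norm_nonneg ψ)
      _ = _ := by ring
  have hev := norm_evolution_le hAim ht
  calc _ ≤ _ := norm_evolution_conj_le S hconj t
    _ ≤ 3 / 2 * Real.exp (2 * KE * (μ * z ^ (N + 1)) * t) * 2 := by gcongr
    _ = _ := by ring

/-- The Lieb–Robinson bound with velocity of order `μ ^ (1 - p₀)`, uniformly in the potential. -/
theorem upper_bound (hd : 0 < d) (p : Fin d → ℕ) (hp : ∀ i, 0 < p i) {ρ₀ : ℝ} (hρ : 0 < ρ₀)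
    (s : ℝ≥0∞) :
    ∃ C C₁ μ₀ : ℝ, 0 < C ∧ 0 < C₁ ∧ 0 < μ₀ ∧
      ∀ (V : (Fin d → ℤ) → ℝ) (hV : IsPeriodic p V), IsNondegenerate p V → separation p V = s →
        ∀ μ : ℝ, μ₀ ≤ μ →
          LiebRobinsonBound (schrodinger (fun n => μ * V n) ((hV.isBounded hp).const_mul μ))
            C ρ₀ (C₁ * μ ^ (-(minPeriod p : ℤ) + 1)) := by
  have : ∀ i, NeZero (p i) := fun i => ⟨(hp i).ne'⟩
  obtain ⟨g, hg, hgap⟩ := exists_gap p s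
  obtain ⟨i₀, hi₀⟩ := exists_minPeriod hd p
  obtain ⟨N, hN⟩ : ∃ N, minPeriod p = N + 1 :=
    Nat.exists_eq_succ_of_ne_zero (by rw [← hi₀]; exact (hp i₀).ne')
  obtain ⟨K, μ₀, hK, hμ₀, hgrow⟩ := exists_growth_bound d (Real.exp_nonneg ρ₀) hg N
  refine ⟨3, K / ρ₀, μ₀, by norm_num, by positivity, by linarith, ?_⟩
  intro V hV hnd hs μ hμ n m t ht
  have hμ0 : 0 < μ := by linarith
  rw [inner_delta]
  -- the sign of `η` is chosen so that the weight decays along the displacement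
  set η : Fin d → ℝ := fun i => if m i ≤ n i then -ρ₀ else ρ₀ with hη
  have habs : ∀ i, |η i| ≤ ρ₀ := fun i => by
    simp only [hη]
    split_ifs
    · rw [abs_neg, abs_of_pos hρ]
    · rw [abs_of_pos hρ]
  have hsum : ∑ i, η i * ((n i : ℝ) - m i) = -ρ₀ * lOneDist n m := by
    rw [lOneDist, Int.cast_sum, Finset.mul_sum]
    refine Finset.sum_congr rfl fun i _ => ?_
    simp only [hη, Int.cast_abs, Int.cast_sub]
    split_ifs with h
    · rw [abs_of_nonneg (sub_nonneg.2 (by exact_mod_cast h))]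
    · rw [abs_of_neg (sub_neg.2 (by exact_mod_cast not_le.1 h))]
      ring
  have hU := hgrow (fun i => Real.exp (η i)) (fun i => Real.exp (-η i)) V (hV.isBounded hp)
    (fun i => by
      rw [abs_of_pos (Real.exp_pos _)]
      exact Real.exp_le_exp.2 ((le_abs_self _).trans (habs i)))
    (fun i => by
      rw [abs_of_pos (Real.exp_pos _)]
      exact Real.exp_le_exp.2 ((neg_le_abs _).trans (habs i)))
    (hgap V hV hnd hs)
    (fun n m h hne => hN ▸ minPeriod_le_lOneDist (residue_eq_of_eq hV hnd h) hne) μ hμ t ht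
  have hpow : μ * μ⁻¹ ^ (N + 1) = μ ^ (-(minPeriod p : ℤ) + 1) := by
    rw [hN, zpow_add₀ hμ0.ne', zpow_neg, zpow_natCast, zpow_one, inv_pow, mul_comm]
  rw [hpow] at hU
  rw [evolution_entry η, hsum, norm_mul, Complex.norm_real, Real.norm_of_nonneg (Real.exp_nonneg _)]
  have h1 : ‖(evolution (hopOp (fun i => Real.exp (η i)) (fun i => Real.exp (-η i))
      (fun n => μ * V n) ((hV.isBounded hp).const_mul μ)) t) (delta m) n‖
      ≤ 3 * Real.exp (K * μ ^ (-(minPeriod p : ℤ) + 1) * t) := by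
    refine (norm_apply_le _ n).trans ((ContinuousLinearMap.le_opNorm _ _).trans ?_)
    rwa [norm_delta, mul_one]
  calc _ ≤ Real.exp (-ρ₀ * lOneDist n m)
        * (3 * Real.exp (K * μ ^ (-(minPeriod p : ℤ) + 1) * t)) :=
        mul_le_mul_of_nonneg_left h1 (Real.exp_nonneg _)
    _ = _ := by
      rw [mul_left_comm, ← Real.exp_add]
      congr 2
      field_simp
      ring


/-! ### The leading order of the matrix elements of polynomials in `V + zΔ` -/

section Leading

open Polynomial

variable (V : (Fin d → ℤ) → ℝ) (r : Fin d → ℤ)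

/-- The weight of the hopping from `n + k` to `n` after the rescaling by `z ^ |n - r|₁`: a step away
from the base point `r` has weight `1`, and a step towards it has weight `w = z²`. -/
noncomputable def rescaledWeight (w : ℂ) (n k : Fin d → ℤ) : ℂ :=
  if lOneDist (n + k) r < lOneDist n r then 1 else w

/-- The operator `z ^ (-|n - r|₁) (V + zΔ) z ^ |n - r|₁`, with `w = z²`, on arbitrary functions. It
makes sense at `w = 0`, where only the steps away from `r` remain. -/
noncomputable def rescaledOp (w : ℂ) : Module.End ℂ ((Fin d → ℤ) → ℂ) where
  toFun ψ n := V n * ψ n + ∑ i, (rescaledWeight r w n (Pi.single i 1) * ψ (n + Pi.single i 1)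
    + rescaledWeight r w n (Pi.single i (-1)) * ψ (n + Pi.single i (-1)))
  map_add' ψ φ := by
    funext n
    simp only [Pi.add_apply, mul_add, Finset.sum_add_distrib]
    ring
  map_smul' c ψ := by
    funext n
    simp only [Pi.smul_apply, smul_eq_mul, RingHom.id_apply, mul_add, Finset.mul_sum,
      mul_left_comm c]

theorem rescaledOp_apply (w : ℂ) (ψ : (Fin d → ℤ) → ℂ) (n : Fin d → ℤ) :
    rescaledOp V r w ψ n = V n * ψ n
      + ∑ i, (rescaledWeight r w n (Pi.single i 1) * ψ (n + Pi.single i 1)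
        + rescaledWeight r w n (Pi.single i (-1)) * ψ (n + Pi.single i (-1))) := rfl

/-- The function `δ_r`, without reference to `ℓ²`. -/
noncomputable def deltaFun : (Fin d → ℤ) → ℂ := fun n => if n = r then 1 else 0

theorem lOneDist_step (n : Fin d → ℤ) (i : Fin d) {c : ℤ} (hc : |c| = 1) :
    lOneDist (n + Pi.single i c) r = lOneDist n r + 1 ∨
      lOneDist (n + Pi.single i c) r = lOneDist n r - 1 := by
  rw [lOneDist_add_single]
  rcases abs_cases (n i - r i) with h1 | h1 <;> rcases abs_cases (n i + c - r i) with h2 | h2 <;>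
    rcases abs_cases c with h3 | h3 <;> omega

theorem rescaledWeight_spec (z : ℂ) (n : Fin d → ℤ) (i : Fin d) {c : ℤ} (hc : |c| = 1) :
    z * z ^ (lOneDist (n + Pi.single i c) r).toNat
      = z ^ (lOneDist n r).toNat * rescaledWeight r (z ^ 2) n (Pi.single i c) := by
  have h0 := lOneDist_nonneg (n + Pi.single i c) r
  have h0' := lOneDist_nonneg n r
  rw [rescaledWeight]
  rcases lOneDist_step r n i hc with h | h
  · rw [if_neg (by omega), ← pow_succ', ← pow_add]
    congr 1
    omega
  · rw [if_pos (by omega), ← pow_succ', mul_one]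
    congr 1
    omega

theorem hopOp_rescale (hV : IsBoundedPotential V) (z : ℝ) {ψ : EllTwo d} {φ : (Fin d → ℤ) → ℂ}
    (h : ∀ n, ψ n = (z : ℂ) ^ (lOneDist n r).toNat * φ n) (n : Fin d → ℤ) :
    hopOp (fun _ => z) (fun _ => z) V hV ψ n
      = (z : ℂ) ^ (lOneDist n r).toNat * rescaledOp V r ((z : ℂ) ^ 2) φ n := by
  rw [hopOp_apply, hop, rescaledOp_apply, mul_add, Finset.mul_sum, h]
  congr 1
  · ring
  refine Finset.sum_congr rfl fun i _ => ?_
  rw [h, h, ← mul_assoc, ← mul_assoc, rescaledWeight_spec r z n i (by simp),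
    rescaledWeight_spec r z n i (by simp)]
  ring

theorem aeval_hopOp_entry (hV : IsBoundedPotential V) (z : ℝ) (F : ℂ[X]) (n : Fin d → ℤ) :
    aeval (hopOp (fun _ => z) (fun _ => z) V hV) F (delta r) n
      = (z : ℂ) ^ (lOneDist n r).toNat
        * aeval (rescaledOp V r ((z : ℂ) ^ 2)) F (deltaFun r) n := by
  have hpow : ∀ (k : ℕ) (n : Fin d → ℤ),
      ((hopOp (fun _ => z) (fun _ => z) V hV) ^ k) (delta r) n
        = (z : ℂ) ^ (lOneDist n r).toNat * ((rescaledOp V r ((z : ℂ) ^ 2)) ^ k) (deltaFun r) n := by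
    intro k
    induction k with
    | zero =>
      intro n
      rw [pow_zero, pow_zero, one_apply_eq_self, delta_apply, Module.End.one_apply, deltaFun]
      split_ifs with h
      · rw [h, lOneDist_self]
        simp
      · simp
    | succ k ih =>
      intro n
      rw [pow_succ', pow_succ', mul_apply_eq_comp, Module.End.mul_apply]
      exact hopOp_rescale V r hV z ih n
  rw [aeval_eq_sum_range, aeval_eq_sum_range]
  simp only [sum_apply, LinearMap.sum_apply, lp.coeFn_sum, Finset.sum_apply, smul_apply,
    LinearMap.smul_apply, lp.coeFn_smul, Pi.smul_apply, hpow, Finset.mul_sum, smul_eq_mul,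
    mul_left_comm]

theorem continuous_aeval_rescaledOp (F : ℂ[X]) (n : Fin d → ℤ) :
    Continuous fun w : ℂ => aeval (rescaledOp V r w) F (deltaFun r) n := by
  have hpow : ∀ (k : ℕ) (n : Fin d → ℤ),
      Continuous fun w : ℂ => ((rescaledOp V r w) ^ k) (deltaFun r) n := by
    intro k
    induction k with
    | zero => exact fun n => continuous_const
    | succ k ih =>
      intro n
      simp only [pow_succ', Module.End.mul_apply, rescaledOp_apply]
      have hw : ∀ k, Continuous fun w : ℂ => rescaledWeight r w n k := by
        intro k
        unfold rescaledWeight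
        split_ifs
        · exact continuous_const
        · exact continuous_id
      refine (continuous_const.mul (ih n)).add (continuous_finsetSum _ fun i _ => ?_)
      exact ((hw _).mul (ih _)).add ((hw _).mul (ih _))
  simp only [aeval_eq_sum_range, LinearMap.sum_apply, Finset.sum_apply, LinearMap.smul_apply,
    Pi.smul_apply, smul_eq_mul]
  exact continuous_finsetSum _ fun k _ => continuous_const.mul (hpow k n)

variable (i₀ : Fin d)

/-- The `l`-th point of the ray from `r` in direction `e_{i₀}`. -/
def ray (l : ℕ) : Fin d → ℤ := r + Pi.single i₀ (l : ℤ)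

theorem ray_zero : ray r i₀ 0 = r := by simp [ray]

theorem lOneDist_ray (l : ℕ) : lOneDist (ray r i₀ l) r = l := by
  rw [ray, lOneDist_add_single, lOneDist_self]
  simp

/-- On a ray from `r`, the only step away from `r` that arrives at a point of the ray comes from the
preceding point, so that the rescaled operator at `w = 0` acts as a bidiagonal matrix. -/
theorem rescaledOp_zero_ray (ψ : (Fin d → ℤ) → ℂ) (l : ℕ) :
    rescaledOp V r 0 ψ (ray r i₀ l) = V (ray r i₀ l) * ψ (ray r i₀ l)
      + if l = 0 then 0 else ψ (ray r i₀ (l - 1)) := by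
  rw [rescaledOp_apply]
  congr 1
  have hcoord : ∀ i, i ≠ i₀ → ray r i₀ l i - r i = 0 := by
    intro i hi
    simp [ray, Pi.single_eq_of_ne hi]
  have hcoord₀ : ray r i₀ l i₀ - r i₀ = l := by simp [ray]
  have hdist : ∀ i c, lOneDist (ray r i₀ l + Pi.single i c) r
      = lOneDist (ray r i₀ l) r - |ray r i₀ l i - r i| + |ray r i₀ l i - r i + c| := by
    intro i c
    rw [lOneDist_add_single]
    congr 2
    ring
  rw [Finset.sum_eq_single i₀]
  · have h1 : rescaledWeight r 0 (ray r i₀ l) (Pi.single i₀ 1) = 0 := by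
      rw [rescaledWeight, if_neg]
      rw [hdist, hcoord₀, abs_of_nonneg (by omega), abs_of_nonneg (by omega)]
      omega
    rw [h1, zero_mul, zero_add]
    rcases Nat.eq_zero_or_pos l with rfl | hl
    · rw [if_pos rfl, rescaledWeight, if_neg, zero_mul]
      rw [hdist, hcoord₀]
      simp
    · rw [if_neg (by omega), rescaledWeight, if_pos, one_mul]
      · congr 1
        rw [ray, ray, add_assoc, ← Pi.single_add]
        congr 2
        omega
      · rw [hdist, hcoord₀, abs_of_nonneg (by omega), abs_of_nonneg (by omega)]
        omega
  · intro i _ hi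
    rw [rescaledWeight, rescaledWeight, if_neg, if_neg, zero_mul, zero_mul, add_zero]
    · rw [hdist, hcoord i hi]
      simp
    · rw [hdist, hcoord i hi]
      simp
  · simp

/-- The factors `X - V(r + l e)`, `l < L`, move `δ_r` along the ray by `L` steps. -/
theorem aeval_nodal_ray (L l : ℕ) :
    aeval (rescaledOp V r 0) (∏ j ∈ Finset.range L, (X - C (V (ray r i₀ j) : ℂ))) (deltaFun r)
      (ray r i₀ l) = if l = L then 1 else 0 := by
  induction L generalizing l with
  | zero =>
    rw [Finset.prod_range_zero, map_one, Module.End.one_apply, deltaFun]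
    have : ray r i₀ l = r ↔ l = 0 := by
      constructor
      · intro h
        have := lOneDist_ray r i₀ l
        rw [h, lOneDist_self] at this
        omega
      · rintro rfl
        exact ray_zero r i₀
    simp only [this]
  | succ L ih =>
    rw [Finset.prod_range_succ_comm, map_mul, Module.End.mul_apply, map_sub, aeval_X, aeval_C,
      LinearMap.sub_apply, Pi.sub_apply, rescaledOp_zero_ray, Module.algebraMap_end_apply,
      Pi.smul_apply, smul_eq_mul, ih, ih]
    rcases Nat.eq_zero_or_pos l with rfl | hl
    · rw [if_pos rfl]
      rcases Nat.eq_zero_or_pos L with rfl | hL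
      · simp
      · simp [hL.ne]
    · by_cases h : l = L
      · subst h
        simp [hl.ne', show l - 1 ≠ l by omega]
      · by_cases h' : l = L + 1
        · subst h'
          simp
        · simp [h, h', hl.ne', show l - 1 ≠ L by omega]

/-- If `ψ` vanishes at the first `L` points of the ray, then a polynomial in the rescaled operator at
`w = 0` acts at the next point by its value at the potential there. -/
theorem aeval_rescaledOp_zero_ray (G : ℂ[X]) {L : ℕ} {ψ : (Fin d → ℤ) → ℂ}
    (hψ : ∀ l < L, ψ (ray r i₀ l) = 0) :
    aeval (rescaledOp V r 0) G ψ (ray r i₀ L) = G.eval (V (ray r i₀ L) : ℂ) * ψ (ray r i₀ L) := by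
  have hpow : ∀ k : ℕ, (∀ l < L, ((rescaledOp V r 0) ^ k) ψ (ray r i₀ l) = 0) ∧
      ((rescaledOp V r 0) ^ k) ψ (ray r i₀ L)
        = (V (ray r i₀ L) : ℂ) ^ k * ψ (ray r i₀ L) := by
    intro k
    induction k with
    | zero => exact ⟨fun l hl => by simpa using hψ l hl, by simp⟩
    | succ k ih =>
      simp only [pow_succ', Module.End.mul_apply, rescaledOp_zero_ray]
      constructor
      · intro l hl
        rw [ih.1 l hl, ih.1 (l - 1) (by omega)]
        simp
      · rw [ih.2]
        split_ifs with h
        · ring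
        · rw [ih.1 (L - 1) (by omega)]
          ring
  rw [aeval_eq_sum_range, eval_eq_sum_range, Finset.sum_mul]
  simp only [LinearMap.sum_apply, Finset.sum_apply, LinearMap.smul_apply, Pi.smul_apply,
    (hpow _).2, smul_eq_mul, mul_assoc]

end Leading


section LeadPoly

open Polynomial

variable {p : Fin d → ℕ} {V : (Fin d → ℤ) → ℝ}

/-- The points `r, r + e, …, r + (p - 1) e` of a ray have different classes modulo the periods. -/
theorem injOn_residue_ray (r : Fin d → ℤ) (i₀ : Fin d) :
    Set.InjOn (fun j : ℕ => residue p (ray r i₀ j)) (Finset.range (p i₀)) := by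
  intro j hj k hk h
  have h1 := congrFun h i₀
  simp only [residue, ray, Pi.add_apply, Pi.single_eq_same, Int.cast_add, Int.cast_natCast,
    add_right_inj] at h1
  have h2 := (ZMod.natCast_eq_natCast_iff' _ _ _).1 h1
  rwa [Nat.mod_eq_of_lt (by simpa using hj), Nat.mod_eq_of_lt (by simpa using hk)] at h2

theorem residue_ray_period (r : Fin d → ℤ) (i₀ : Fin d) :
    residue p (ray r i₀ (p i₀)) = residue p r := by
  rw [ray, residue_add, add_eq_left]
  funext i
  by_cases h : i = i₀
  · subst h
    simp [residue]
  · simp [residue, Pi.single_eq_of_ne h]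

variable [∀ i, NeZero (p i)]

/-- There is a polynomial `F` for which the leading coefficients, of order `z ^ p_{i₀}`, of the
matrix elements of `F(V + zΔ)` between `r` and `r + p_{i₀} e_{i₀}` have a non-zero sum over the
fundamental cell. The coefficient at `r` is the divided difference of `F` at the values of `V` along
the ray from `r` to `r + p_{i₀} e_{i₀}`, the value `V r` being a double node. `F` is chosen to vanish
at all values of `V`, with multiplicity two except at a single value. -/
theorem exists_leading_ne_zero (hV : IsPeriodic p V) (hnd : IsNondegenerate p V) (i₀ : Fin d) :
    ∃ F : ℂ[X], ∑ s : ∀ i, ZMod (p i), aeval (rescaledOp V (cellRep p s) 0) F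
      (deltaFun (cellRep p s)) (ray (cellRep p s) i₀ (p i₀)) ≠ 0 := by
  classical
  set v : (∀ i, ZMod (p i)) → ℂ := fun s => (V (cellRep p s) : ℂ) with hv
  have hvinj : Function.Injective v := by
    intro s s' h
    have h1 := residue_eq_of_eq hV hnd (Complex.ofReal_injective h)
    rwa [residue_cellRep, residue_cellRep] at h1
  have hvres : ∀ n, (V n : ℂ) = v (residue p n) := fun n => by
    rw [hv]
    exact congrArg _ (IsPeriodic.eq_of_residue hV (residue_cellRep _).symm)
  set F : (∀ i, ZMod (p i)) → ℂ[X] := fun s => X - C (v s) with hF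
  refine ⟨(∏ s, F s) * ∏ s ∈ Finset.univ.erase 0, F s, ?_⟩
  have hval : ∀ s, aeval (rescaledOp V (cellRep p s) 0)
        ((∏ s, F s) * ∏ s ∈ Finset.univ.erase 0, F s) (deltaFun (cellRep p s))
        (ray (cellRep p s) i₀ (p i₀))
      = (∏ s' ∈ Finset.univ \ (Finset.range (p i₀)).image
          (fun j : ℕ => residue p (ray (cellRep p s) i₀ j)), (v s - v s'))
        * ∏ s' ∈ Finset.univ.erase 0, (v s - v s') := by
    intro s
    set T := (Finset.range (p i₀)).image (fun j : ℕ => residue p (ray (cellRep p s) i₀ j)) with hT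
    have hN : ∏ s' ∈ T, F s'
        = ∏ j ∈ Finset.range (p i₀), (X - C (V (ray (cellRep p s) i₀ j) : ℂ)) := by
      rw [hT, Finset.prod_image (injOn_residue_ray _ _)]
      simp only [hF, hvres]
    rw [← Finset.prod_sdiff (Finset.subset_univ T), mul_right_comm, hN, map_mul,
      Module.End.mul_apply, aeval_rescaledOp_zero_ray, aeval_nodal_ray, if_pos rfl, mul_one,
      eval_mul, eval_prod, eval_prod, hvres, residue_ray_period, residue_cellRep]
    · simp only [hF, eval_sub, eval_X, eval_C]
    · intro l hl
      rw [aeval_nodal_ray, if_neg hl.ne]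
  rw [Finset.sum_eq_single 0]
  · rw [hval]
    refine mul_ne_zero (Finset.prod_ne_zero_iff.2 fun s hs => ?_)
      (Finset.prod_ne_zero_iff.2 fun s hs => ?_)
    · refine sub_ne_zero.2 (hvinj.ne ?_)
      rintro rfl
      refine (Finset.mem_sdiff.1 hs).2 (Finset.mem_image.2 ⟨0, ?_, ?_⟩)
      · exact Finset.mem_range.2 (Nat.pos_of_ne_zero (NeZero.ne _))
      · rw [ray_zero, residue_cellRep]
    · exact sub_ne_zero.2 (hvinj.ne (Finset.ne_of_mem_erase hs).symm)
  · intro s _ hs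
    rw [hval, Finset.prod_eq_zero (s := Finset.univ.erase 0) (i := s)
      (Finset.mem_erase.2 ⟨hs, Finset.mem_univ s⟩) (sub_self (v s)), mul_zero]
  · simp

end LeadPoly

/-! ### Periodic operators and the trace per unit cell -/

section Trace

variable (p : Fin d → ℕ)

/-- An operator is `p`-periodic if it commutes with the translations by the period lattice. -/
def IsPeriodicOp (A : EllTwo d →L[ℂ] EllTwo d) : Prop :=
  ∀ k : Fin d → ℤ, Commute A (shiftOp fun i => (p i : ℤ) * k i)

variable {p}

theorem IsPeriodicOp.mul {A B : EllTwo d →L[ℂ] EllTwo d} (hA : IsPeriodicOp p A)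
    (hB : IsPeriodicOp p B) : IsPeriodicOp p (A * B) := fun k => (hA k).mul_left (hB k)

theorem IsPeriodicOp.pow {A : EllTwo d →L[ℂ] EllTwo d} (hA : IsPeriodicOp p A) (j : ℕ) :
    IsPeriodicOp p (A ^ j) := fun k => (hA k).pow_left j

theorem commute_shiftOp (k l : Fin d → ℤ) : Commute (shiftOp k) (shiftOp l) := by
  refine ext_entry fun n m => ?_
  rw [mul_apply_eq_comp, mul_apply_eq_comp, shiftOp_apply, shiftOp_apply, shiftOp_apply,
    shiftOp_apply, add_right_comm]

theorem isPeriodicOp_shiftOp (k : Fin d → ℤ) : IsPeriodicOp p (shiftOp k) :=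
  fun _ => commute_shiftOp _ _

theorem isPeriodicOp_hopOp (a b : Fin d → ℝ) {V : (Fin d → ℤ) → ℝ} (hV : IsPeriodic p V)
    (hb : IsBoundedPotential V) : IsPeriodicOp p (hopOp a b V hb) := by
  intro k
  refine Commute.add_left ?_ (Commute.sum_left _ _ _ fun i _ => ?_)
  · refine ext_entry fun n m => ?_
    rw [mul_apply_eq_comp, mul_apply_eq_comp, shiftOp_apply, potentialOp_apply, potentialOp_apply,
      shiftOp_apply]
    congr 2
    exact (hV n k).symm
  · exact ((commute_shiftOp _ _).smul_left _).add_left ((commute_shiftOp _ _).smul_left _)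

theorem IsPeriodicOp.entry_eq {A : EllTwo d →L[ℂ] EllTwo d} (hA : IsPeriodicOp p A)
    (n m k : Fin d → ℤ) :
    A (delta (m + fun i => (p i : ℤ) * k i)) (n + fun i => (p i : ℤ) * k i) = A (delta m) n := by
  have h := congrArg (fun B : EllTwo d →L[ℂ] EllTwo d =>
    B (delta (m + fun i => (p i : ℤ) * k i)) n) (hA k).eq
  simp only [mul_apply_eq_comp, shiftOp_apply, shiftOp_delta, add_sub_cancel_right] at h
  exact h.symm

variable [∀ i, NeZero (p i)]

variable (p) in
/-- The trace per unit cell: the sum of the diagonal matrix elements over the fundamental cell. -/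
noncomputable def cellTrace : (EllTwo d →L[ℂ] EllTwo d) →L[ℂ] ℂ :=
  ∑ s : ∀ i, ZMod (p i), (evalCLM (cellRep p s)).comp
    (ContinuousLinearMap.apply ℂ (EllTwo d) (delta (cellRep p s)))

theorem cellTrace_apply (A : EllTwo d →L[ℂ] EllTwo d) :
    cellTrace p A = ∑ s : ∀ i, ZMod (p i), A (delta (cellRep p s)) (cellRep p s) := by
  simp [cellTrace, evalCLM_apply]

theorem cellTrace_shiftOp_comm {A : EllTwo d →L[ℂ] EllTwo d} (hA : IsPeriodicOp p A)
    (c : Fin d → ℤ) : cellTrace p (A * shiftOp c) = cellTrace p (shiftOp c * A) := by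
  rw [cellTrace_apply, cellTrace_apply, ← Equiv.sum_comp (Equiv.subRight (residue p c))
    (fun s => (shiftOp c * A) (delta (cellRep p s)) (cellRep p s))]
  refine Finset.sum_congr rfl fun s _ => ?_
  rw [mul_apply_eq_comp, mul_apply_eq_comp, shiftOp_delta, shiftOp_apply, Equiv.subRight_apply]
  have h1 : residue p (cellRep p s)
      = residue p (cellRep p (s - residue p c) + c) := by
    rw [residue_add, residue_cellRep, residue_cellRep, sub_add_cancel]
  obtain ⟨k, hk⟩ := (residue_eq_iff _ _).1 h1
  have h2 : cellRep p s
      = (cellRep p (s - residue p c) + c) + fun i => (p i : ℤ) * k i := hk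
  have h3 : cellRep p s - c = cellRep p (s - residue p c) + fun i => (p i : ℤ) * k i := by
    rw [h2]
    abel
  rw [h3, h2]
  exact hA.entry_eq _ _ k

theorem cellTrace_hopOp_comm {A : EllTwo d →L[ℂ] EllTwo d} (hA : IsPeriodicOp p A)
    (a b : Fin d → ℝ) {V : (Fin d → ℤ) → ℝ} (hb : IsBoundedPotential V) :
    cellTrace p (A * hopOp a b V hb) = cellTrace p (hopOp a b V hb * A) := by
  have hpot : cellTrace p (A * potentialOp V hb) = cellTrace p (potentialOp V hb * A) := by
    rw [cellTrace_apply, cellTrace_apply]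
    refine Finset.sum_congr rfl fun s _ => ?_
    rw [mul_apply_eq_comp, mul_apply_eq_comp, potentialOp_delta, map_smul, potentialOp_apply]
    rfl
  simp only [hopOp, mul_add, add_mul, Finset.mul_sum, Finset.sum_mul, map_add, map_sum,
    mul_smul_comm, smul_mul_assoc, map_smul, hpot, cellTrace_shiftOp_comm hA]

theorem cellTrace_hopOp_pow_comm {A : EllTwo d →L[ℂ] EllTwo d} (hA : IsPeriodicOp p A)
    (a b : Fin d → ℝ) {V : (Fin d → ℤ) → ℝ} (hV : IsPeriodic p V) (hb : IsBoundedPotential V)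
    (j : ℕ) : cellTrace p (A * hopOp a b V hb ^ j) = cellTrace p (hopOp a b V hb ^ j * A) := by
  have hh := isPeriodicOp_hopOp a b hV hb
  induction j generalizing A with
  | zero => simp
  | succ j ih =>
    rw [pow_succ, ← mul_assoc, cellTrace_hopOp_comm (hA.mul (hh.pow j)), ← mul_assoc,
      ih (hh.mul hA), mul_assoc]

end Trace

/-! ### The commutator with the position operator -/

section Derivation

open Polynomial

variable (i₀ : Fin d)

/-- The commutator of the coordinate `n_{i₀}` with the hopping `zΔ`. -/
noncomputable def velocityOp (z : ℝ) : EllTwo d →L[ℂ] EllTwo d :=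
  (-z : ℂ) • shiftOp (Pi.single i₀ 1) + (z : ℂ) • shiftOp (Pi.single i₀ (-1))

theorem velocityOp_apply (z : ℝ) (ψ : EllTwo d) (n : Fin d → ℤ) :
    velocityOp i₀ z ψ n
      = -z * ψ (n + Pi.single i₀ 1) + z * ψ (n + Pi.single i₀ (-1)) := by
  simp only [velocityOp, add_apply, smul_apply, lp.coeFn_add, lp.coeFn_smul, Pi.add_apply,
    Pi.smul_apply, shiftOp_apply, smul_eq_mul]

theorem isPeriodicOp_velocityOp (p : Fin d → ℕ) (z : ℝ) : IsPeriodicOp p (velocityOp i₀ z) :=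
  fun _ => ((commute_shiftOp _ _).smul_left _).add_left ((commute_shiftOp _ _).smul_left _)

/-- `D` is the commutator of the coordinate `n_{i₀}` with `A`, in the sense of matrix elements. -/
def IsPositionCommutator (A D : EllTwo d →L[ℂ] EllTwo d) : Prop :=
  ∀ n m, D (delta m) n = ((n i₀ - m i₀ : ℤ) : ℂ) * A (delta m) n

variable {V : (Fin d → ℤ) → ℝ} (hb : IsBoundedPotential V) (z : ℝ)

theorem hop_eq_add_sum_erase {R : Type*} [Semiring R] (a b : Fin d → R)
    (f : (Fin d → ℤ) → R) (n : Fin d → ℤ) :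
    hop a b f n = a i₀ * f (n + Pi.single i₀ 1) + b i₀ * f (n + Pi.single i₀ (-1))
      + ∑ i ∈ Finset.univ.erase i₀,
        (a i * f (n + Pi.single i 1) + b i * f (n + Pi.single i (-1))) :=
  (Finset.add_sum_erase _ _ (Finset.mem_univ i₀)).symm

variable {i₀} in
/-- The Leibniz rule. -/
theorem IsPositionCommutator.hopOp_mul {A D : EllTwo d →L[ℂ] EllTwo d}
    (h : IsPositionCommutator i₀ A D) :
    IsPositionCommutator i₀ (hopOp (fun _ => z) (fun _ => z) V hb * A)
      (hopOp (fun _ => z) (fun _ => z) V hb * D + velocityOp i₀ z * A) := by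
  intro n m
  rw [add_apply, mul_apply_eq_comp, mul_apply_eq_comp, mul_apply_eq_comp, lp.coeFn_add,
    Pi.add_apply, hopOp_apply, hopOp_apply, velocityOp_apply, hop_eq_add_sum_erase i₀,
    hop_eq_add_sum_erase i₀]
  have hrest : ∑ i ∈ Finset.univ.erase i₀, ((z : ℂ) * (D (delta m)) (n + Pi.single i 1)
        + z * (D (delta m)) (n + Pi.single i (-1)))
      = ((n i₀ - m i₀ : ℤ) : ℂ) * ∑ i ∈ Finset.univ.erase i₀,
        ((z : ℂ) * (A (delta m)) (n + Pi.single i 1)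
          + z * (A (delta m)) (n + Pi.single i (-1))) := by
    rw [Finset.mul_sum]
    refine Finset.sum_congr rfl fun i hi => ?_
    have h0 : ∀ c : ℤ, (n + Pi.single i c : Fin d → ℤ) i₀ = n i₀ := fun c => by
      rw [Pi.add_apply, Pi.single_eq_of_ne (Finset.ne_of_mem_erase hi).symm, add_zero]
    rw [h, h, h0, h0]
    ring
  rw [hrest, h, h, h, Pi.add_apply, Pi.add_apply, Pi.single_eq_same, Pi.single_eq_same]
  push_cast
  ring

/-- The commutator of the coordinate `n_{i₀}` with the powers of `V + zΔ`. -/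
noncomputable def powCommutator : ℕ → EllTwo d →L[ℂ] EllTwo d
  | 0 => 0
  | k + 1 => hopOp (fun _ => z) (fun _ => z) V hb * powCommutator k
      + velocityOp i₀ z * hopOp (fun _ => z) (fun _ => z) V hb ^ k

theorem isPositionCommutator_pow (k : ℕ) :
    IsPositionCommutator i₀ (hopOp (fun _ => z) (fun _ => z) V hb ^ k)
      (powCommutator i₀ hb z k) := by
  induction k with
  | zero =>
    intro n m
    rw [powCommutator, pow_zero, one_apply_eq_self, delta_apply, zero_apply]
    split_ifs with h
    · simp [h]
    · simp
  | succ k ih =>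
    rw [pow_succ', powCommutator]
    exact ih.hopOp_mul hb z

theorem norm_pow_le_of_le {A : EllTwo d →L[ℂ] EllTwo d} {M : ℝ} (h : ‖A‖ ≤ M) (k : ℕ) :
    ‖A ^ k‖ ≤ M ^ k := by
  induction k with
  | zero =>
    rw [pow_zero, pow_zero]
    exact ContinuousLinearMap.norm_id_le
  | succ k ih =>
    rw [pow_succ, pow_succ]
    exact (norm_mul_le _ _).trans
      (mul_le_mul ih h (norm_nonneg _) ((norm_nonneg _).trans ih))

theorem norm_powCommutator_le {M : ℝ} (h1 : ‖hopOp (fun _ => z) (fun _ => z) V hb‖ ≤ M)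
    (h2 : ‖velocityOp i₀ z‖ ≤ M) (k : ℕ) : ‖powCommutator i₀ hb z k‖ ≤ k * M ^ k := by
  have hM : 0 ≤ M := (norm_nonneg _).trans h1
  induction k with
  | zero => simp [powCommutator]
  | succ k ih =>
    rw [powCommutator]
    refine (norm_add_le _ _).trans ((add_le_add (norm_mul_le _ _) (norm_mul_le _ _)).trans ?_)
    have h3 := mul_le_mul h1 ih (norm_nonneg _) hM
    have h4 := mul_le_mul h2 (norm_pow_le_of_le h1 k) (norm_nonneg _) hM
    push_cast
    rw [pow_succ]
    linarith

variable {p : Fin d → ℕ} [∀ i, NeZero (p i)]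

/-- Under the trace, against a periodic operator commuting with `h = V + zΔ`, the factors of the
commutator with `h ^ (k + 1)` can be rearranged as for commuting variables. -/
theorem cellTrace_powCommutator (hV : IsPeriodic p V) {B : EllTwo d →L[ℂ] EllTwo d} (hB : IsPeriodicOp p B)
    (hc : Commute B (hopOp (fun _ => z) (fun _ => z) V hb)) (k : ℕ) :
    cellTrace p (B * powCommutator i₀ hb z (k + 1))
      = (k + 1) * cellTrace p (B * hopOp (fun _ => z) (fun _ => z) V hb ^ k * velocityOp i₀ z) := by
  have hh := isPeriodicOp_hopOp (fun _ => z) (fun _ => z) hV hb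
  induction k generalizing B with
  | zero => simp [powCommutator]
  | succ k ih =>
    rw [powCommutator, mul_add, map_add, ← mul_assoc, ih (hB.mul hh) (hc.mul_left (Commute.refl _)),
      ← mul_assoc, cellTrace_hopOp_pow_comm (hB.mul (isPeriodicOp_velocityOp i₀ p z)) _ _ hV,
      ← mul_assoc, ← (hc.pow_right (k + 1)).eq, mul_assoc B, ← pow_succ']
    push_cast
    ring

end Derivation


section FunctionalCalculus

open Polynomial

variable (i₀ : Fin d) {V : (Fin d → ℤ) → ℝ} (hb : IsBoundedPotential V) (z : ℝ)
  {p : Fin d → ℕ} [∀ i, NeZero (p i)]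

/-- Under the trace, the commutator of the coordinate with `F(h)` acts as `F'(h) h'`, where `h'` is
the commutator with `h = V + zΔ`: the case of polynomials. -/
theorem exists_aeval_commutator (hV : IsPeriodic p V) (F : ℂ[X]) :
    ∃ D : EllTwo d →L[ℂ] EllTwo d,
      IsPositionCommutator i₀ (aeval (hopOp (fun _ => z) (fun _ => z) V hb) F) D ∧
      ∀ B, IsPeriodicOp p B → Commute B (hopOp (fun _ => z) (fun _ => z) V hb) →
        cellTrace p (B * D) = cellTrace p
          (B * aeval (hopOp (fun _ => z) (fun _ => z) V hb) (derivative F) * velocityOp i₀ z) := by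
  induction F using Polynomial.induction_on' with
  | add F G hF hG =>
    obtain ⟨D, hD, hDt⟩ := hF
    obtain ⟨E, hE, hEt⟩ := hG
    refine ⟨D + E, fun n m => ?_, fun B hB hc => ?_⟩
    · rw [add_apply, lp.coeFn_add, Pi.add_apply, hD, hE, map_add, add_apply, lp.coeFn_add,
        Pi.add_apply, mul_add]
    · rw [mul_add, map_add, hDt B hB hc, hEt B hB hc, map_add, map_add, mul_add, add_mul, map_add]
  | monomial k c =>
    refine ⟨c • powCommutator i₀ hb z k, fun n m => ?_, fun B hB hc => ?_⟩
    · rw [aeval_monomial, ← Algebra.smul_def, smul_apply, smul_apply, lp.coeFn_smul, lp.coeFn_smul,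
        Pi.smul_apply, Pi.smul_apply, isPositionCommutator_pow, smul_eq_mul, smul_eq_mul,
        mul_left_comm]
    · rw [derivative_monomial, aeval_monomial, ← Algebra.smul_def, mul_smul_comm, mul_smul_comm,
        smul_mul_assoc, map_smul, map_smul]
      cases k with
      | zero => simp [powCommutator]
      | succ k =>
        rw [cellTrace_powCommutator i₀ hb z hV hB hc, Nat.add_sub_cancel, smul_eq_mul, smul_eq_mul]
        push_cast
        ring

/-- The analogue of `exists_aeval_commutator` for the exponential function. -/
theorem exists_exp_commutator (hV : IsPeriodic p V) (c : ℂ) :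
    ∃ D : EllTwo d →L[ℂ] EllTwo d,
      IsPositionCommutator i₀
        (NormedSpace.exp (c • hopOp (fun _ => z) (fun _ => z) V hb)) D ∧
      ∀ B, IsPeriodicOp p B → Commute B (hopOp (fun _ => z) (fun _ => z) V hb) →
        cellTrace p (B * D) = c * cellTrace p (B *
          NormedSpace.exp (c • hopOp (fun _ => z) (fun _ => z) V hb) * velocityOp i₀ z) := by
  set h := hopOp (fun _ => z) (fun _ => z) V hb with hh
  set M := max ‖h‖ ‖velocityOp i₀ z‖ with hM
  have hM0 : 0 ≤ M := (norm_nonneg _).trans (le_max_left _ _)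
  have hsum : Summable fun k : ℕ =>
      ((k.factorial : ℂ)⁻¹ * c ^ k) • powCommutator i₀ hb z k := by
    refine Summable.of_norm_bounded (Real.summable_pow_div_factorial (2 * (‖c‖ * M))) fun k => ?_
    have h1 := norm_powCommutator_le i₀ hb z (le_max_left _ _) (le_max_right _ _) k
    have h2 : (k : ℝ) ≤ 2 ^ k := by exact_mod_cast Nat.lt_two_pow_self.le
    rw [norm_smul, norm_mul, norm_inv, norm_pow, Complex.norm_natCast]
    calc (k.factorial : ℝ)⁻¹ * ‖c‖ ^ k * ‖powCommutator i₀ hb z k‖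
        ≤ (k.factorial : ℝ)⁻¹ * ‖c‖ ^ k * (2 ^ k * M ^ k) := by
          refine mul_le_mul_of_nonneg_left (h1.trans ?_) (by positivity)
          exact mul_le_mul_of_nonneg_right h2 (by positivity)
      _ = _ := by
          rw [mul_pow, mul_pow]
          ring
  obtain ⟨D, hD⟩ := hsum
  refine ⟨D, fun n m => ?_, fun B hB hc => ?_⟩
  · have h1 := ((evalCLM n).comp (ContinuousLinearMap.apply ℂ (EllTwo d) (delta m))).hasSum hD
    refine HasSum.unique ?_ ((hasSum_exp_entry c h n m).mul_left _)
    have h2 : D (delta m) n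
        = ((evalCLM n).comp (ContinuousLinearMap.apply ℂ (EllTwo d) (delta m))) D := by
      simp [evalCLM_apply]
    rw [h2]
    refine h1.congr_fun fun k => ?_
    rw [map_smul, ContinuousLinearMap.comp_apply, ContinuousLinearMap.apply_apply, evalCLM_apply,
      isPositionCommutator_pow, smul_eq_mul]
    ring
  · obtain ⟨L₁, hL₁⟩ : ∃ L : (EllTwo d →L[ℂ] EllTwo d) →L[ℂ] ℂ,
        ∀ A, L A = cellTrace p (B * A) :=
      ⟨(cellTrace p).comp (ContinuousLinearMap.mul ℂ _ B), fun A => rfl⟩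
    obtain ⟨L₂, hL₂⟩ : ∃ L : (EllTwo d →L[ℂ] EllTwo d) →L[ℂ] ℂ,
        ∀ A, L A = cellTrace p (B * A * velocityOp i₀ z) :=
      ⟨(cellTrace p).comp ((ContinuousLinearMap.mul ℂ _ B).comp
        ((ContinuousLinearMap.mul ℂ (EllTwo d →L[ℂ] EllTwo d)).flip (velocityOp i₀ z))), fun A => by
          rw [mul_assoc]
          rfl⟩
    have h1 := L₁.hasSum hD
    have h2 := (L₂.hasSum (NormedSpace.exp_series_hasSum_exp' (𝕂 := ℂ) (c • h))).mul_left c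
    rw [← hL₁, ← hL₂]
    have h0 : L₁ (((Nat.factorial 0 : ℂ)⁻¹ * c ^ 0) • powCommutator i₀ hb z 0) = 0 := by
      rw [powCommutator, smul_zero, map_zero]
    refine h1.unique ((hasSum_nat_add_iff' 1).1 ?_)
    rw [Finset.sum_range_one, h0, sub_zero]
    refine h2.congr_fun fun k => ?_
    have h8 : (k.factorial : ℂ) ≠ 0 := Nat.cast_ne_zero.2 k.factorial_ne_zero
    have h9 : (k : ℂ) + 1 ≠ 0 := Nat.cast_add_one_ne_zero k
    rw [_root_.smul_pow, map_smul, map_smul, map_smul, hL₁, hL₂,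
      cellTrace_powCommutator i₀ hb z hV hB hc, ← hh, Nat.factorial_succ, smul_eq_mul, smul_eq_mul,
      smul_eq_mul]
    generalize cellTrace p (B * h ^ k * velocityOp i₀ z) = x
    push_cast
    field_simp
    ring

end FunctionalCalculus

/-! ### Unitarity and norm bounds -/

theorem inner_shiftOp_im (k : Fin d → ℤ) (ψ : EllTwo d) :
    (inner ℂ ψ (shiftOp k ψ + shiftOp (-k) ψ)).im = 0 := by
  have h : inner ℂ ψ (shiftOp (-k) ψ) = inner ℂ (shiftOp k ψ) ψ := by
    rw [lp.inner_eq_tsum, lp.inner_eq_tsum, ← (Equiv.addRight k).tsum_eq]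
    refine tsum_congr fun n => ?_
    rw [shiftOp_apply, shiftOp_apply, Equiv.coe_addRight, add_neg_cancel_right]
  rw [inner_add_right, h, Complex.add_im, ← inner_conj_symm ψ, Complex.conj_im]
  ring

theorem inner_hopOp_im (z : ℝ) {V : (Fin d → ℤ) → ℝ} (hb : IsBoundedPotential V) (ψ : EllTwo d) :
    (inner ℂ ψ (hopOp (fun _ => z) (fun _ => z) V hb ψ)).im = 0 := by
  rw [hopOp, add_apply, inner_add_right, Complex.add_im, inner_potentialOp_im, zero_add, sum_apply,
    inner_sum, Complex.im_sum]
  refine Finset.sum_eq_zero fun i _ => ?_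
  rw [add_apply, smul_apply, smul_apply, ← smul_add, inner_smul_right, Pi.single_neg,
    Complex.im_ofReal_mul, inner_shiftOp_im, mul_zero]

theorem norm_exp_hopOp_le (z : ℝ) {V : (Fin d → ℤ) → ℝ} (hb : IsBoundedPotential V) (τ : ℝ) :
    ‖NormedSpace.exp ((-(Complex.I * (τ : ℂ))) • hopOp (fun _ => z) (fun _ => z) V hb)‖ ≤ 1 := by
  rcases le_total 0 τ with h | h
  · refine (norm_evolution_le (r := 0) (fun ψ => ?_) h).trans (by simp)
    rw [inner_hopOp_im, abs_zero, zero_mul]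
  · have h1 := norm_evolution_le (A := -hopOp (fun _ => z) (fun _ => z) V hb) (r := 0)
      (fun ψ => by
        rw [neg_apply, inner_neg_right, Complex.neg_im, inner_hopOp_im, neg_zero, abs_zero,
          zero_mul])
      (neg_nonneg.2 h)
    rw [evolution, smul_neg, ← neg_smul] at h1
    simpa using h1

theorem norm_hopOp_le {z B : ℝ} (hz0 : 0 ≤ z) {V : (Fin d → ℤ) → ℝ}
    (hb : IsBoundedPotential V) (hB : ∀ n, |V n| ≤ B) :
    ‖hopOp (fun _ => z) (fun _ => z) V hb‖ ≤ B + d * (2 * z) := by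
  refine (norm_add_le _ _).trans (add_le_add (potentialOp_norm_le V hb hB) ?_)
  refine (norm_sum_le _ _).trans ?_
  have h1 : ∀ k : Fin d → ℤ, ‖(z : ℂ) • shiftOp k‖ ≤ z := fun k => by
    rw [norm_smul, Complex.norm_real, Real.norm_of_nonneg hz0]
    exact mul_le_of_le_one_right hz0 (shiftOp_norm_le k)
  refine (Finset.sum_le_card_nsmul _ _ (2 * z) fun i _ => ?_).trans (by simp)
  refine (norm_add_le _ _).trans ?_
  linarith [h1 (Pi.single i 1), h1 (Pi.single i (-1))]

theorem norm_aeval_le (G : Polynomial ℂ) {M : ℝ} {A : EllTwo d →L[ℂ] EllTwo d} (h : ‖A‖ ≤ M) :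
    ‖Polynomial.aeval A G‖ ≤ ∑ k ∈ Finset.range (G.natDegree + 1), ‖G.coeff k‖ * M ^ k := by
  rw [Polynomial.aeval_eq_sum_range]
  refine norm_sum_le_of_le _ fun k _ => ?_
  rw [norm_smul]
  exact mul_le_mul_of_nonneg_left (norm_pow_le_of_le h k) (norm_nonneg _)

/-! ### Spreading under a Lieb–Robinson bound -/

theorem summable_prod_pi {f : ℤ → ℝ} (hf : Summable f) (h0 : ∀ x, 0 ≤ f x) (d : ℕ) :
    Summable fun k : Fin d → ℤ => ∏ i, f (k i) := by
  induction d with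
  | zero => exact Summable.of_finite
  | succ d ih =>
    rw [← (Fin.consEquiv fun _ : Fin (d + 1) => ℤ).summable_iff]
    refine (hf.mul_of_nonneg ih h0 fun k => Finset.prod_nonneg fun i _ => h0 _).congr fun x => ?_
    simp [Fin.prod_univ_succ, Fin.consEquiv]

theorem summable_exp_neg_abs {b : ℝ} (hb : 0 < b) :
    Summable fun x : ℤ => Real.exp (-b * |(x : ℝ)|) := by
  have h : Summable fun n : ℕ => Real.exp (-b * n) := by
    have := Real.summable_exp_nat_mul_iff.2 (neg_lt_zero.2 hb)
    simpa [mul_comm] using this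
  refine Summable.of_nat_of_neg ?_ ?_
  · simpa using h
  · simpa using h

/-- Exponential weights dominate second moments on the lattice. -/
theorem summable_sq_mul_exp {b : ℝ} (hb : 0 < b) (m : Fin d → ℤ) :
    Summable fun n : Fin d → ℤ =>
      (lOneDist n m : ℝ) ^ 2 * Real.exp (-b * lOneDist n m) := by
  have h1 : Summable fun k : Fin d → ℤ => ∏ i, Real.exp (-(b / 2) * |(k i : ℝ)|) :=
    summable_prod_pi (summable_exp_neg_abs (half_pos hb)) (fun _ => Real.exp_nonneg _) d
  have h2 := ((Equiv.subRight m).summable_iff.2 h1).mul_left (2 * (b / 2)⁻¹ ^ 2)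
  refine Summable.of_nonneg_of_le (fun n => by positivity) (fun n => ?_) h2
  have h3 : ∏ i, Real.exp (-(b / 2) * |(((Equiv.subRight m) n) i : ℝ)|)
      = Real.exp (-(b / 2) * lOneDist n m) := by
    rw [← Real.exp_sum, lOneDist, Int.cast_sum, Finset.mul_sum]
    simp
  rw [Function.comp_apply, h3]
  have hx : (0 : ℝ) ≤ b / 2 * lOneDist n m :=
    mul_nonneg (half_pos hb).le (by exact_mod_cast lOneDist_nonneg n m)
  have h4 := Real.quadratic_le_exp_of_nonneg hx
  have h5 : (lOneDist n m : ℝ) ^ 2 ≤ 2 * (b / 2)⁻¹ ^ 2 * Real.exp (b / 2 * lOneDist n m) := by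
    have h6 : (b / 2 * lOneDist n m) ^ 2 ≤ 2 * Real.exp (b / 2 * lOneDist n m) := by linarith
    calc (lOneDist n m : ℝ) ^ 2 = (b / 2)⁻¹ ^ 2 * (b / 2 * lOneDist n m) ^ 2 := by
          field_simp
      _ ≤ (b / 2)⁻¹ ^ 2 * (2 * Real.exp (b / 2 * lOneDist n m)) := by gcongr
      _ = _ := by ring
  refine (mul_le_mul_of_nonneg_right h5 (Real.exp_nonneg _)).trans (le_of_eq ?_)
  rw [mul_assoc, ← Real.exp_add]
  congr 2
  ring

/-- A normalized state that obeys a Lieb–Robinson bound with velocity `v` at time `t` has root mean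
square displacement at most `(v + ε) t`, up to a constant: outside the ball of radius `(v + ε) t`
the bound decays exponentially in the distance. -/
theorem exists_moment_bound {K ρ v ε : ℝ} (hρ : 0 < ρ) (hv : 0 ≤ v) (hε : 0 < ε) (m : Fin d → ℤ)
    (i₀ : Fin d) :
    ∃ C : ℝ, 0 ≤ C ∧ ∀ (t : ℝ) (f g : EllTwo d), 0 ≤ t → ‖f‖ ≤ 1 →
      (∀ n, ‖f n‖ ≤ K * Real.exp (-ρ * ((lOneDist n m : ℝ) - v * t))) →
      (∀ n, g n = ((n i₀ - m i₀ : ℤ) : ℂ) * f n) → ‖g‖ ≤ (v + ε) * t + C := by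
  have hvε : 0 < v + ε := by linarith
  set b : ℝ := 2 * (ρ * (ε / (v + ε))) with hbdef
  have hb : 0 < b := by positivity
  have hs := (summable_sq_mul_exp hb m).mul_left (K ^ 2)
  set Q := ∑' n : Fin d → ℤ, K ^ 2 * ((lOneDist n m : ℝ) ^ 2 * Real.exp (-b * lOneDist n m))
    with hQ
  have hQ0 : 0 ≤ Q := tsum_nonneg fun n => by positivity
  refine ⟨√Q, Real.sqrt_nonneg _, fun t f g ht hf hfb hg => ?_⟩
  have hnorm : ∀ u : EllTwo d, HasSum (fun n => ‖u n‖ ^ 2) (‖u‖ ^ 2) := fun u => by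
    have := lp.hasSum_norm (by norm_num : (0 : ℝ) < (2 : ℝ≥0∞).toReal) u
    simpa using this
  have hle : ‖g‖ ^ 2 ≤ ((v + ε) * t) ^ 2 * ‖f‖ ^ 2 + Q := by
    refine hasSum_le (fun n => ?_) (hnorm g) (((hnorm f).mul_left _).add hs.hasSum)
    rw [hg, norm_mul, mul_pow]
    have hD0 : (0 : ℝ) ≤ lOneDist n m := by exact_mod_cast lOneDist_nonneg n m
    have h1 : ‖((n i₀ - m i₀ : ℤ) : ℂ)‖ ≤ lOneDist n m := by
      rw [Complex.norm_intCast]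
      exact_mod_cast abs_sub_le_lOneDist n m i₀
    have h2 : ‖((n i₀ - m i₀ : ℤ) : ℂ)‖ ^ 2 ≤ (lOneDist n m : ℝ) ^ 2 :=
      pow_le_pow_left₀ (norm_nonneg _) h1 2
    rcases le_total (lOneDist n m : ℝ) ((v + ε) * t) with h | h
    · have h3 : (lOneDist n m : ℝ) ^ 2 ≤ ((v + ε) * t) ^ 2 := pow_le_pow_left₀ hD0 h 2
      have h4 := mul_le_mul_of_nonneg_right (h2.trans h3) (sq_nonneg ‖f n‖)
      have h5 : 0 ≤ K ^ 2 * ((lOneDist n m : ℝ) ^ 2 * Real.exp (-b * lOneDist n m)) := by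
        positivity
      linarith
    · have h3 : ‖f n‖ ^ 2 ≤ K ^ 2 * Real.exp (-b * lOneDist n m) := by
        have h4 : ε / (v + ε) * lOneDist n m ≤ (lOneDist n m : ℝ) - v * t := by
          have h5 : v * t ≤ v * (lOneDist n m / (v + ε)) := by
            refine mul_le_mul_of_nonneg_left ?_ hv
            rw [le_div_iff₀ hvε]
            linarith
          have h6 : ε / (v + ε) * lOneDist n m
              = (lOneDist n m : ℝ) - v * (lOneDist n m / (v + ε)) := by
            field_simp
            ring
          linarith
        calc ‖f n‖ ^ 2 ≤ (K * Real.exp (-ρ * ((lOneDist n m : ℝ) - v * t))) ^ 2 :=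
              pow_le_pow_left₀ (norm_nonneg _) (hfb n) 2
          _ = K ^ 2 * Real.exp (2 * (-ρ * ((lOneDist n m : ℝ) - v * t))) := by
              rw [mul_pow, ← Real.exp_nat_mul]
              norm_num
          _ ≤ K ^ 2 * Real.exp (-b * lOneDist n m) := by
              refine mul_le_mul_of_nonneg_left (Real.exp_le_exp.2 ?_) (sq_nonneg K)
              have := mul_le_mul_of_nonneg_left h4 hρ.le
              rw [hbdef]
              linarith
      have h4 := mul_le_mul h2 h3 (sq_nonneg _) (sq_nonneg _)
      have h5 : 0 ≤ ((v + ε) * t) ^ 2 * ‖f n‖ ^ 2 := by positivity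
      linarith
  have hf2 : ‖f‖ ^ 2 ≤ 1 := pow_le_one₀ (norm_nonneg _) hf
  have h1 : ‖g‖ ^ 2 ≤ ((v + ε) * t + √Q) ^ 2 := by
    have h2 := Real.sq_sqrt hQ0
    have h3 : 0 ≤ (v + ε) * t * √Q := by positivity
    have h4 := mul_le_mul_of_nonneg_left hf2 (sq_nonneg ((v + ε) * t))
    nlinarith
  exact le_of_sq_le_sq h1 (by positivity)


/-! ### The lower bound on the velocity -/

section Lower

open Polynomial

variable (i₀ : Fin d) {p : Fin d → ℕ} {V : (Fin d → ℤ) → ℝ}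

/-- The translation by the period in direction `e_{i₀}`. -/
noncomputable def periodShift (p : Fin d → ℕ) : EllTwo d →L[ℂ] EllTwo d :=
  shiftOp fun i => (p i : ℤ) * (Pi.single i₀ 1 : Fin d → ℤ) i

theorem periodShift_apply (ψ : EllTwo d) (r : Fin d → ℤ) :
    periodShift i₀ p ψ r = ψ (ray r i₀ (p i₀)) := by
  have h : (fun i => (p i : ℤ) * (Pi.single i₀ 1 : Fin d → ℤ) i) = Pi.single i₀ (p i₀ : ℤ) := by
    funext i
    by_cases h : i = i₀
    · subst h
      simp
    · simp [Pi.single_eq_of_ne h]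
  rw [periodShift, shiftOp_apply, ray, h]

theorem commute_aeval {A B : EllTwo d →L[ℂ] EllTwo d} (h : Commute A B) (G : ℂ[X]) :
    Commute (aeval A G) B := by
  rw [aeval_eq_sum_range]
  exact Commute.sum_left _ _ _ fun k _ => (h.pow_left k).smul_left _

variable [∀ i, NeZero (p i)]

/-- Let `U = e^{-iτh}` with `h = V + zΔ`, let `D` be its commutator with the coordinate, and let `T`
be the translation by a period. Since `D` acts like `-iτ U h'` under the trace per cell, and
`F'(h) h'` like the commutator with `F(h)`, the trace of `T F'(h) U⁻¹ D` is `-iτ` times a quantity that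
does not depend on `τ`. -/
theorem exists_commutator_growth (hV : IsPeriodic p V) (hb : IsBoundedPotential V) (z : ℝ)
    (F : ℂ[X]) (τ : ℝ) :
    ∃ D : EllTwo d →L[ℂ] EllTwo d,
      IsPositionCommutator i₀ (NormedSpace.exp ((-(Complex.I * (τ : ℂ)))
        • hopOp (fun _ => z) (fun _ => z) V hb)) D ∧
      |τ| * (p i₀ * ‖∑ s : ∀ i, ZMod (p i), aeval (hopOp (fun _ => z) (fun _ => z) V hb) F
          (delta (cellRep p s)) (ray (cellRep p s) i₀ (p i₀))‖)
        ≤ ‖aeval (hopOp (fun _ => z) (fun _ => z) V hb) (derivative F)‖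
          * ∑ s : ∀ i, ZMod (p i), ‖D (delta (cellRep p s))‖ := by
  set h := hopOp (fun _ => z) (fun _ => z) V hb with hh
  set c : ℂ := -(Complex.I * (τ : ℂ)) with hc
  have hper : IsPeriodicOp p h := isPeriodicOp_hopOp _ _ hV hb
  have hT : Commute (periodShift i₀ p) h := (hper _).symm
  have hTper : IsPeriodicOp p (periodShift i₀ p) := isPeriodicOp_shiftOp _
  obtain ⟨D, hD, hDt⟩ := exists_exp_commutator i₀ hb z hV c
  obtain ⟨D', hD', hDt'⟩ := exists_aeval_commutator i₀ hb z hV F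
  refine ⟨D, hD, ?_⟩
  set f := aeval h (derivative F) with hf
  set U' := NormedSpace.exp ((-c) • h) with hU'
  have hcf : Commute f h := commute_aeval (Commute.refl h) _
  have hcU : Commute U' h := ((Commute.refl h).smul_left (-c)).exp_left
  have hperf : IsPeriodicOp p f := fun k => commute_aeval (hper k) _
  have hperU : IsPeriodicOp p U' := fun k => ((hper k).smul_left (-c)).exp_left
  have hUU : U' * NormedSpace.exp (c • h) = 1 := by
    let _ : NormedAlgebra ℚ (EllTwo d →L[ℂ] EllTwo d) := NormedAlgebra.restrictScalars ℚ ℂ _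
    rw [hU', ← NormedSpace.exp_add_of_commute, neg_smul, neg_add_cancel, NormedSpace.exp_zero]
    exact ((Commute.refl h).smul_left _).smul_right _
  have h1 : cellTrace p (periodShift i₀ p * f * U' * D)
      = c * cellTrace p (periodShift i₀ p * f * velocityOp i₀ z) := by
    rw [hDt _ ((hTper.mul hperf).mul hperU) ((hT.mul_left hcf).mul_left hcU),
      mul_assoc (periodShift i₀ p * f) U', hUU, mul_one]
  have h2 : cellTrace p (periodShift i₀ p * f * velocityOp i₀ z)
      = p i₀ * ∑ s : ∀ i, ZMod (p i), aeval h F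
          (delta (cellRep p s)) (ray (cellRep p s) i₀ (p i₀)) := by
    rw [← hDt' _ hTper hT, cellTrace_apply, Finset.mul_sum]
    refine Finset.sum_congr rfl fun s _ => ?_
    rw [mul_apply_eq_comp, periodShift_apply, hD']
    simp [ray, hh]
  have hcn : ‖c‖ = |τ| := by
    rw [hc, norm_neg, norm_mul, Complex.norm_I, one_mul, Complex.norm_real, Real.norm_eq_abs]
  have hU'n : ‖U'‖ ≤ 1 := by
    have := norm_exp_hopOp_le z hb (-τ)
    rwa [Complex.ofReal_neg, mul_neg] at this
  have hBn : ‖periodShift i₀ p * f * U'‖ ≤ ‖f‖ := by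
    refine (norm_mul_le _ _).trans ((mul_le_mul_of_nonneg_left hU'n (norm_nonneg _)).trans ?_)
    rw [mul_one]
    exact (norm_mul_le _ _).trans
      (mul_le_of_le_one_left (norm_nonneg _) (shiftOp_norm_le _))
  calc |τ| * (p i₀ * ‖∑ s : ∀ i, ZMod (p i), aeval h F
          (delta (cellRep p s)) (ray (cellRep p s) i₀ (p i₀))‖)
      = ‖cellTrace p (periodShift i₀ p * f * U' * D)‖ := by
        rw [h1, h2, norm_mul, norm_mul, hcn, Complex.norm_natCast]
    _ ≤ ∑ s : ∀ i, ZMod (p i), ‖f‖ * ‖D (delta (cellRep p s))‖ := by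
        rw [cellTrace_apply]
        refine norm_sum_le_of_le _ fun s _ => ?_
        rw [mul_apply_eq_comp]
        refine (norm_apply_le _ _).trans ((ContinuousLinearMap.le_opNorm _ _).trans ?_)
        exact mul_le_mul_of_nonneg_right hBn (norm_nonneg _)
    _ = _ := by rw [Finset.mul_sum]

/-- If an affine function of `t` dominates `a t` on the half line, then its slope is at least `a`. -/
theorem le_of_forall_mul_le_add {a b q : ℝ} (h : ∀ t : ℝ, 0 ≤ t → a * t ≤ b * t + q) : a ≤ b := by
  by_contra! hlt
  have h0 : 0 < a - b := sub_pos.2 hlt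
  have h1 := h ((|q| + 1) / (a - b)) (by positivity)
  have h2 : (a - b) * ((|q| + 1) / (a - b)) = |q| + 1 := by
    field_simp
  have h3 := le_abs_self q
  linarith

theorem schrodinger_eq_smul {μ : ℝ} (hμ : μ ≠ 0) (hb : IsBoundedPotential V) :
    schrodinger (fun n => μ * V n) (hb.const_mul μ)
      = (μ : ℂ) • hopOp (fun _ => μ⁻¹) (fun _ => μ⁻¹) V hb := by
  ext ψ n
  have h : (μ : ℂ) ≠ 0 := Complex.ofReal_ne_zero.2 hμ
  rw [schrodinger_apply, smul_apply, lp.coeFn_smul, Pi.smul_apply, hopOp_apply, hop, smul_eq_mul,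
    mul_add, Finset.mul_sum]
  congr 1
  · push_cast
    ring
  · refine Finset.sum_congr rfl fun i _ => ?_
    push_cast
    field_simp

/-- Every Lieb–Robinson velocity is at least of order `μ ^ (1 - p_{i₀})`. -/
theorem lower_bound (hV : IsPeriodic p V) (hnd : IsNondegenerate p V)
    (hb : IsBoundedPotential V) :
    ∃ c μ₁ : ℝ, 0 < c ∧ 0 < μ₁ ∧ ∀ μ : ℝ, μ₁ ≤ μ → ∀ ρ C v : ℝ, 0 < ρ →
      LiebRobinsonBound (schrodinger (fun n => μ * V n) (hb.const_mul μ)) C ρ v →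
        c * μ ^ (-(p i₀ : ℤ) + 1) ≤ v := by
  obtain ⟨F, hF⟩ := exists_leading_ne_zero hV hnd i₀
  obtain ⟨BV, hBV⟩ := id hb
  set Φ : ℂ → ℂ := fun w => ∑ s : ∀ i, ZMod (p i), aeval (rescaledOp V (cellRep p s) w) F
      (deltaFun (cellRep p s)) (ray (cellRep p s) i₀ (p i₀)) with hΦ
  have hΦ0 : 0 < ‖Φ 0‖ := norm_pos_iff.2 hF
  have hΦc : Continuous fun w => ‖Φ w‖ :=
    (continuous_finsetSum _ fun s _ => continuous_aeval_rescaledOp V _ F _).norm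
  obtain ⟨δ, hδ, hΦδ⟩ := Metric.eventually_nhds_iff.1
    (hΦc.continuousAt.eventually (lt_mem_nhds (half_lt_self hΦ0)))
  set β : ℝ := (∑ k ∈ Finset.range ((derivative F).natDegree + 1),
    ‖(derivative F).coeff k‖ * (BV + d * (2 * 1)) ^ k) + 1 with hβ
  have hBV0 : 0 ≤ BV := (abs_nonneg _).trans (hBV 0)
  have hβ0 : 0 < β := by positivity
  have hp0 : (0 : ℝ) < p i₀ := Nat.cast_pos.2 (Nat.pos_of_ne_zero (NeZero.ne _))
  set κ : ℝ := (Fintype.card (∀ i, ZMod (p i)) : ℝ) with hκ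
  have hκ0 : 0 < κ := Nat.cast_pos.2 (Fintype.card_pos)
  refine ⟨p i₀ * (‖Φ 0‖ / 2) / (β * κ), δ⁻¹ + 1, by positivity, by positivity, ?_⟩
  intro μ hμ ρ C v hρ hLR
  have hδ0 : 0 < δ⁻¹ := inv_pos.2 hδ
  have hμ0 : 0 < μ := by linarith
  set z := μ⁻¹ with hz
  have hz0 : 0 < z := inv_pos.2 hμ0
  have hz1 : z ≤ 1 := inv_le_one_of_one_le₀ (by linarith)
  have hzδ : z < δ := inv_lt_of_inv_lt₀ hδ (by linarith)
  set h := hopOp (fun _ => z) (fun _ => z) V hb with hh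
  have hevol : ∀ t : ℝ, evolution (schrodinger (fun n => μ * V n) (hb.const_mul μ)) t
      = NormedSpace.exp ((-(Complex.I * ((t * μ : ℝ) : ℂ))) • h) := by
    intro t
    rw [evolution, schrodinger_eq_smul hμ0.ne' hb, smul_smul]
    congr 2
    push_cast
    ring
  have hlead : ∑ s : ∀ i, ZMod (p i), aeval h F (delta (cellRep p s))
      (ray (cellRep p s) i₀ (p i₀)) = (z : ℂ) ^ p i₀ * Φ ((z : ℂ) ^ 2) := by
    rw [hΦ, Finset.mul_sum]
    refine Finset.sum_congr rfl fun s _ => ?_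
    rw [hh, aeval_hopOp_entry, lOneDist_ray, Int.toNat_natCast]
  have hΦz : ‖Φ 0‖ / 2 ≤ ‖Φ ((z : ℂ) ^ 2)‖ := by
    refine (hΦδ ?_).le
    rw [dist_zero_right, norm_pow, Complex.norm_real, Real.norm_of_nonneg hz0.le]
    nlinarith
  have hfn : ‖aeval h (derivative F)‖ ≤ β := by
    refine (norm_aeval_le (derivative F) ((norm_hopOp_le hz0.le hb hBV).trans ?_)).trans
      (le_add_of_nonneg_right zero_le_one)
    gcongr
  set v₀ := max v 0 with hv₀
  have hv₀0 : 0 ≤ v₀ := le_max_right _ _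
  have hC : 0 ≤ C := by
    have := (norm_nonneg _).trans (hLR 0 0 0 le_rfl)
    rw [lOneDist_self] at this
    simpa using this
  have hLR₀ : ∀ (m n : Fin d → ℤ) (t : ℝ), 0 ≤ t →
      ‖evolution (schrodinger (fun n => μ * V n) (hb.const_mul μ)) t (delta m) n‖
        ≤ C * Real.exp (-ρ * ((lOneDist n m : ℝ) - v₀ * t)) := by
    intro m n t ht
    have h1 := hLR n m t ht
    rw [inner_delta] at h1
    refine h1.trans (mul_le_mul_of_nonneg_left (Real.exp_le_exp.2 ?_) hC)
    have h2 := mul_le_mul_of_nonneg_right (le_max_left v 0) ht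
    nlinarith
  have hslope : ∀ ε : ℝ, 0 < ε →
      μ * (p i₀ * (z ^ p i₀ * (‖Φ 0‖ / 2))) ≤ β * κ * (v₀ + ε) := by
    intro ε hε
    choose Q hQ0 hQ using fun s : ∀ i, ZMod (p i) =>
      exists_moment_bound (K := C) hρ hv₀0 hε (cellRep p s) i₀
    refine le_of_forall_mul_le_add (q := β * ∑ s, Q s) fun t ht => ?_
    obtain ⟨D, hD, hDle⟩ := exists_commutator_growth i₀ hV hb z F (t * μ)
    rw [← hh] at hD hDle
    have hDn : ∀ s, ‖D (delta (cellRep p s))‖ ≤ (v₀ + ε) * t + Q s := by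
      intro s
      refine hQ s t (NormedSpace.exp ((-(Complex.I * ((t * μ : ℝ) : ℂ))) • h)
        (delta (cellRep p s))) _ ht ?_ (fun n => ?_) (fun n => hD n _)
      · refine (ContinuousLinearMap.le_opNorm _ _).trans ?_
        rw [norm_delta, mul_one]
        exact norm_exp_hopOp_le z hb _
      · rw [← hevol]
        exact hLR₀ _ n t ht
    have hsum : ∑ s : ∀ i, ZMod (p i), ‖D (delta (cellRep p s))‖
        ≤ κ * ((v₀ + ε) * t) + ∑ s, Q s := by
      refine (Finset.sum_le_sum fun s _ => hDn s).trans (le_of_eq ?_)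
      rw [Finset.sum_add_distrib, Finset.sum_const, nsmul_eq_mul, Finset.card_univ]
    have hsum0 : 0 ≤ ∑ s : ∀ i, ZMod (p i), ‖D (delta (cellRep p s))‖ :=
      Finset.sum_nonneg fun _ _ => norm_nonneg _
    rw [hlead, norm_mul, norm_pow, Complex.norm_real, Real.norm_of_nonneg hz0.le,
      abs_of_nonneg (by positivity)] at hDle
    calc μ * (p i₀ * (z ^ p i₀ * (‖Φ 0‖ / 2))) * t
        = t * μ * (p i₀ * (z ^ p i₀ * (‖Φ 0‖ / 2))) := by ring
      _ ≤ t * μ * (p i₀ * (z ^ p i₀ * ‖Φ ((z : ℂ) ^ 2)‖)) := by gcongr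
      _ ≤ _ := hDle
      _ ≤ β * (κ * ((v₀ + ε) * t) + ∑ s, Q s) := mul_le_mul hfn hsum hsum0 hβ0.le
      _ = _ := by ring
  have hmain : μ * (p i₀ * (z ^ p i₀ * (‖Φ 0‖ / 2))) ≤ β * κ * v₀ := by
    refine le_of_forall_pos_le_add fun ε hε => ?_
    have h1 := hslope (ε / (β * κ)) (by positivity)
    have h2 : β * κ * (v₀ + ε / (β * κ)) = β * κ * v₀ + ε := by
      field_simp
    linarith
  have hpow : μ * z ^ p i₀ = μ ^ (-(p i₀ : ℤ) + 1) := by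
    rw [zpow_add₀ hμ0.ne', zpow_neg, zpow_natCast, zpow_one, hz, inv_pow, mul_comm]
  have hle : p i₀ * (‖Φ 0‖ / 2) / (β * κ) * μ ^ (-(p i₀ : ℤ) + 1) ≤ v₀ := by
    rw [div_mul_eq_mul_div, div_le_iff₀ (by positivity), ← hpow]
    linarith
  -- the lower bound is positive, so that the maximum of `v` and `0` is `v`
  have hpos : 0 < p i₀ * (‖Φ 0‖ / 2) / (β * κ) * μ ^ (-(p i₀ : ℤ) + 1) := by positivity
  rcases le_max_iff.1 hle with h1 | h1
  · exact h1
  · exact absurd h1 (not_le.2 hpos)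

end Lower

end LiebRobinson

theorem theorem2 (d : ℕ) (hd : 0 < d) (p : Fin d → ℕ) (hp : ∀ i, 0 < p i) :
    -- upper bound; the constants depend only on `d`, `p`, the separation of `V`, and `ρ₀`
    (∀ (ρ₀ : ℝ), 0 < ρ₀ → ∀ s : ℝ≥0∞,
      ∃ C C₁ μ₀ : ℝ, 0 < C ∧ 0 < C₁ ∧ 0 < μ₀ ∧
        ∀ (V : (Fin d → ℤ) → ℝ) (hV : IsPeriodic p V), IsNondegenerate p V → separation p V = s →
          ∀ μ : ℝ, μ₀ ≤ μ →
            LiebRobinsonBound (schrodinger (fun n => μ * V n) ((hV.isBounded hp).const_mul μ))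
              C ρ₀ (C₁ * μ ^ (-(minPeriod p : ℤ) + 1))) ∧
    -- optimality; any rate `ρ` and any implied constant `C` are allowed
    (∀ (V : (Fin d → ℤ) → ℝ) (hV : IsPeriodic p V), IsNondegenerate p V →
      ∃ c μ₁ : ℝ, 0 < c ∧ 0 < μ₁ ∧
        ∀ μ : ℝ, μ₁ ≤ μ → ∀ ρ C v : ℝ, 0 < ρ →
          LiebRobinsonBound (schrodinger (fun n => μ * V n) ((hV.isBounded hp).const_mul μ))
              C ρ v →
            c * μ ^ (-(minPeriod p : ℤ) + 1) ≤ v) := by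
  refine ⟨fun ρ₀ hρ₀ s => LiebRobinson.upper_bound hd p hp hρ₀ s, fun V hV hnd => ?_⟩
  have : ∀ i, NeZero (p i) := fun i => ⟨(hp i).ne'⟩
  obtain ⟨i₀, hi₀⟩ := LiebRobinson.exists_minPeriod hd p
  rw [← hi₀]
  exact LiebRobinson.lower_bound i₀ hV hnd (hV.isBounded hp)
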